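/- Let $d\ge 2$, and let $|\cdot|$ denote the Euclidean norm on $\mathbb R^d$. For a set $E\subseteq\mathbb R^d$ let $\Delta(E)=\{|x-y| : x,y\in E\}$. For a Borel probability measure $\mu$ on $\mathbb R^d$ put $$\widehat\mu(\xi)=\int e^{-i x\cdot\xi}\,d\mu(x),\qquad \mathbb F_\mu(T)=\int_{|\xi|\le T}|\widehat\mu(\xi)|^2\,d\xi .$$ For every $c\in\bigl(0,\tfrac{d-1}{4}\bigr)$, $T_0\ge 1$ and $M\ge 4$ there is a constant $\delta_M>0$, depending only on $d,c,T_0,M$, with the following property. Let $\mu$ be a Borel probability measure supported on a set $E\subseteq[0,1]^d$ (that is, $\mu(\mathbb R^d\setminus E)=0$) such that $$\mathbb F_\mu(T_1T_2)\le T_1^{c}\,\mathbb F_\mu(T_2)\qquad\text{for all } T_1,T_2\ge T_0 .$$ Suppose that $\delta\in(0,\delta_M)$, $J\ge 1$ and $R_1,\dots,R_J\in(T_0,\infty)$ satisfy $$R_{j+1}\ge\delta^{-2}R_j\quad(1\le j<J)\qquad\text{and}\qquad \sum_{j=1}^{J}\mathbb F_\mu(R_j)>\Bigl(1-\frac2M\Bigr)\mathbb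 F_\mu\bigl(\delta^{-2}R_J\bigr).$$ Then $\delta R_j^{-1}\in\Delta(E)$ for at least one $j\in\{1,\dots,J\}$. -/

import Mathlib

open MeasureTheory

noncomputable section

/-- The distance set of `E`: all Euclidean distances `|x - y|` with `x, y ∈ E`. -/
def distanceSet {d : ℕ} (E : Set (EuclideanSpace ℝ (Fin d))) : Set ℝ :=
  {t : ℝ | ∃ x ∈ E, ∃ y ∈ E, ‖x - y‖ = t}

/-- The closed unit cube `[0,1]^d`. -/
def unitCube (d : ℕ) : Set (EuclideanSpace ℝ (Fin d)) :=
  {x | ∀ i, 0 ≤ x i ∧ x i ≤ 1}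

/-- The Fourier transform of a measure, `ξ ↦ ∫ exp (-i x·ξ) dμ(x)`. -/
def measureFourier {d : ℕ} (μ : Measure (EuclideanSpace ℝ (Fin d)))
    (ξ : EuclideanSpace ℝ (Fin d)) : ℂ :=
  ∫ x, Complex.exp (-(Complex.I * ((inner ℝ x ξ : ℝ) : ℂ))) ∂μ

/-- The partial `L²`-Fourier integral `∫_{|ξ| ≤ T} |μ̂(ξ)|² dξ`. -/
def partialFourierIntegral {d : ℕ} (μ : Measure (EuclideanSpace ℝ (Fin d))) (T : ℝ) : ℝ :=
  ∫ ξ in {ξ : EuclideanSpace ℝ (Fin d) | ‖ξ‖ ≤ T}, ‖measureFourier μ ξ‖ ^ 2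

end

/-!
Let `σ` be the uniform measure on the unit sphere and `a = (d - 1) / 2`. If `t = δ / R` is not a
distance in `E`, then the law of `x - y + t • θ`, with `x, y` drawn from `μ` and `θ` from `σ`, has
no mass near `0` when `E` is compact, so its Fourier transform `|μ̂(ξ)|² σ̂(tξ)` has integral `0`.
The growth hypothesis makes the energy `∫ |μ̂|² |ξ|^(-a)` finite, and with `|σ̂(ξ)| ≲ |ξ|^(-a)` this
carries the vanishing over to arbitrary `E` by inner approximation.

In the vanishing integral, the ball `|ξ| ≤ R`, where `σ̂(tξ) ≈ 1`, contributes almost `𝔽_μ(R)`, the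
tail `|ξ| > δ⁻² R` contributes `O(δ^(a - 2 * c)) 𝔽_μ(R)`, and on the annulus between them `σ̂ ≥ -κ`
for some `κ < 1/2`. Hence the annulus carries mass at least `2 𝔽_μ(R)`. The annuli belonging to
different `R_j` are disjoint, so if no `δ / R_j` were a distance, summing over `j` would contradict
the hypothesis on `∑ 𝔽_μ(R_j)`.

For `κ`: if `0, ξ, η` is an equilateral triangle, the average of `|1 + e^(i⟪θ, ξ⟫) + e^(i⟪θ, η⟫)|²`
over `θ` is `3 + 6 σ̂(ξ) ≥ 0`. In case of equality `cos ⟪θ, ξ⟫ = -1/2` almost surely, which forces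
equality at `2 • ξ`, `4 • ξ`, … as well and contradicts the decay of `σ̂`.
-/

open Filter Topology
open scoped RealInnerProductSpace ENNReal

/-! ### The uniform measure on the sphere -/

section SphereMeasure

variable {V : Type*} [NormedAddCommGroup V] [InnerProductSpace ℝ V] [MeasurableSpace V]

/-- The cosine transform `ξ ↦ ∫ cos ⟪θ, ξ⟫ dσ(θ)` of a measure, which is the Fourier transform of
`σ` if `σ` is symmetric. -/
noncomputable def cosTransform (σ : Measure V) (ξ : V) : ℝ :=
  ∫ θ, Real.cos ⟪θ, ξ⟫ ∂σ

/-- The rotation-invariant probability measure on the unit sphere of `V`, encoded as a measure on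
the ambient space. -/
structure IsUniformSphereMeasure (σ : Measure V) : Prop where
  isProbabilityMeasure : IsProbabilityMeasure σ
  norm_eq_one : ∀ᵐ θ ∂σ, ‖θ‖ = 1
  measurePreserving : ∀ L : V ≃ₗᵢ[ℝ] V, MeasurePreserving L σ σ

theorem exists_isUniformSphereMeasure [BorelSpace V] [FiniteDimensional ℝ V] [Nontrivial V] :
    ∃ σ : Measure V, IsUniformSphereMeasure σ := by
  let B : Set V := Metric.ball 0 1
  let β : Measure V := (volume B)⁻¹ • volume.restrict B
  have hβ : IsProbabilityMeasure β := by
    constructor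
    simp only [β, Measure.smul_apply, Measure.restrict_apply_univ, smul_eq_mul]
    exact ENNReal.inv_mul_cancel (Metric.measure_ball_pos volume _ one_pos).ne'
      measure_ball_lt_top.ne
  have hproj : Measurable fun x : V => ‖x‖⁻¹ • x := by fun_prop
  refine ⟨β.map fun x => ‖x‖⁻¹ • x, Measure.isProbabilityMeasure_map hproj.aemeasurable, ?_, ?_⟩
  · rw [ae_map_iff hproj.aemeasurable (measurableSet_eq_fun (by fun_prop) (by fun_prop))]
    have hne : ∀ᵐ x ∂β, x ≠ 0 := by
      refine Measure.ae_smul_measure (ae_restrict_of_ae ?_) _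
      simp [ae_iff]
    filter_upwards [hne] with x hx
    rw [norm_smul, norm_inv, norm_norm, inv_mul_cancel₀ (norm_ne_zero_iff.2 hx)]
  · intro L
    have hLB : L ⁻¹' B = B := by ext x; simp [B]
    have hLβ : MeasurePreserving L β β := by
      have h := L.measurePreserving.restrict_preimage (s := B) Metric.isOpen_ball.measurableSet
      rw [hLB] at h
      exact h.smul_measure _
    have hcomm : L ∘ (fun x => ‖x‖⁻¹ • x) = (fun x => ‖x‖⁻¹ • x) ∘ L := by
      ext x; simp
    refine ⟨L.continuous.measurable, ?_⟩
    rw [Measure.map_map L.continuous.measurable hproj, hcomm,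
      ← Measure.map_map hproj L.continuous.measurable, hLβ.map_eq]

section CosTransform

variable [OpensMeasurableSpace V] {σ : Measure V}

theorem integrable_cos_inner [IsFiniteMeasure σ] (ξ : V) :
    Integrable (fun θ => Real.cos ⟪θ, ξ⟫) σ :=
  Integrable.of_bound (Continuous.aestronglyMeasurable (by fun_prop)) 1
    (Eventually.of_forall fun _ => Real.abs_cos_le_one _)

theorem continuous_cosTransform [IsFiniteMeasure σ] : Continuous (cosTransform σ) := by
  refine continuous_of_dominated (bound := fun _ => 1)
    (fun ξ => (integrable_cos_inner ξ).aestronglyMeasurable) (fun ξ => ?_)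
    (integrable_const _) (Eventually.of_forall fun θ => by fun_prop)
  exact Eventually.of_forall fun θ => Real.abs_cos_le_one _

end CosTransform

theorem abs_cosTransform_le_one {σ : Measure V} [IsProbabilityMeasure σ] (ξ : V) :
    |cosTransform σ ξ| ≤ 1 := by
  have h : ∀ᵐ θ ∂σ, ‖Real.cos ⟪θ, ξ⟫‖ ≤ 1 := Eventually.of_forall fun _ => Real.abs_cos_le_one _
  simpa [cosTransform] using norm_integral_le_of_norm_le_const h

namespace IsUniformSphereMeasure

section Invariance

variable {σ : Measure V} [BorelSpace V]

theorem integral_comp_isometry {F : Type*} [NormedAddCommGroup F] [NormedSpace ℝ F]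
    (hσ : IsUniformSphereMeasure σ) (L : V ≃ₗᵢ[ℝ] V) (f : V → F) :
    ∫ θ, f (L θ) ∂σ = ∫ θ, f θ ∂σ :=
  (hσ.measurePreserving L).integral_comp L.toHomeomorph.measurableEmbedding f

theorem cosTransform_eq_of_norm_eq (hσ : IsUniformSphereMeasure σ) {ξ η : V} (h : ‖ξ‖ = ‖η‖) :
    cosTransform σ ξ = cosTransform σ η := by
  let L := Submodule.reflection (ℝ ∙ (ξ - η))ᗮ
  have hL : L ξ = η := Submodule.reflection_sub h
  rw [cosTransform, cosTransform, ← hσ.integral_comp_isometry L fun θ => Real.cos ⟪θ, η⟫]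
  simp only [← hL, L.inner_map_map]

theorem charFun_eq_cosTransform (hσ : IsUniformSphereMeasure σ) (ξ : V) :
    charFun σ ξ = cosTransform σ ξ := by
  have := hσ.isProbabilityMeasure
  have hexp : Integrable (fun θ => Complex.exp (⟪θ, ξ⟫ * Complex.I)) σ :=
    Integrable.of_bound (Continuous.aestronglyMeasurable (by fun_prop)) 1 <|
      Eventually.of_forall fun θ => (Complex.norm_exp_ofReal_mul_I _).le
  have hsymm : charFun σ (-ξ) = charFun σ ξ := by
    simpa [charFun_apply] using hσ.integral_comp_isometry (LinearIsometryEquiv.neg ℝ)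
      fun θ => Complex.exp (⟪θ, ξ⟫ * Complex.I)
  rw [charFun_neg, Complex.conj_eq_iff_re] at hsymm
  rw [← hsymm, charFun_apply, ← RCLike.re_eq_complex_re, ← integral_re hexp, cosTransform]
  simp only [RCLike.re_eq_complex_re, Complex.exp_ofReal_mul_I_re]

end Invariance

end IsUniformSphereMeasure

theorem hasDerivAt_integral_comp_inner_mul [OpensMeasurableSpace V] {σ : Measure V}
    {f f' : ℝ → ℝ} (hf : ∀ x, HasDerivAt f (f' x) x) (hf' : Continuous f')
    (hf_le : ∀ x, |f x| ≤ 1) (hf'_le : ∀ x, |f' x| ≤ 1)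
    {g : V → ℝ} (hg : Integrable g σ) (hg' : Integrable (fun θ => ‖θ‖ * g θ) σ)
    (u v : V) (ε : ℝ) :
    HasDerivAt (fun ε : ℝ => ∫ θ, f ⟪θ, u + ε • v⟫ * g θ ∂σ)
      (∫ θ, f' ⟪θ, u + ε • v⟫ * ⟪θ, v⟫ * g θ ∂σ) ε := by
  have hfc : Continuous f := continuous_iff_continuousAt.2 fun x => (hf x).continuousAt
  have hmeas : ∀ x : ℝ, AEStronglyMeasurable (fun θ => f ⟪θ, u + x • v⟫) σ := fun x =>
    Continuous.aestronglyMeasurable (by fun_prop)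
  have hmeas' : AEStronglyMeasurable (fun θ => f' ⟪θ, u + ε • v⟫ * ⟪θ, v⟫) σ :=
    Continuous.aestronglyMeasurable (by fun_prop)
  refine (hasDerivAt_integral_of_dominated_loc_of_deriv_le
    (F := fun ε θ => f ⟪θ, u + ε • v⟫ * g θ) (F' := fun ε θ => f' ⟪θ, u + ε • v⟫ * ⟪θ, v⟫ * g θ)
    (bound := fun θ => ‖v‖ * |‖θ‖ * g θ|) univ_mem
    (Eventually.of_forall fun x => (hmeas x).mul hg.aestronglyMeasurable)
    (hg.bdd_mul (c := 1) (hmeas ε) (Eventually.of_forall fun θ => hf_le _))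
    (hmeas'.mul hg.aestronglyMeasurable) (Eventually.of_forall fun θ x _ => ?_)
    (hg'.abs.const_mul _) (Eventually.of_forall fun θ x _ => ?_)).2
  · calc ‖f' ⟪θ, u + x • v⟫ * ⟪θ, v⟫ * g θ‖
        = |f' ⟪θ, u + x • v⟫| * |⟪θ, v⟫| * |g θ| := by simp only [Real.norm_eq_abs, abs_mul]
      _ ≤ 1 * (‖θ‖ * ‖v‖) * |g θ| := by
          gcongr
          exacts [hf'_le _, abs_real_inner_le_norm θ v]
      _ = ‖v‖ * |‖θ‖ * g θ| := by rw [abs_mul, abs_norm]; ring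
  · have hline : HasDerivAt (fun x : ℝ => ⟪θ, u + x • v⟫) ⟪θ, v⟫ x := by
      simpa [inner_add_right, inner_smul_right] using
        ((hasDerivAt_id x).mul_const ⟪θ, v⟫).const_add ⟪θ, u⟫
    exact ((hf _).comp x hline).mul_const _

namespace IsUniformSphereMeasure

section Derivatives

variable {σ : Measure V} [OpensMeasurableSpace V]

theorem integrable_of_abs_le (hσ : IsUniformSphereMeasure σ) {f : V → ℝ} (hf : Continuous f)
    (C : ℝ) (hC : ∀ θ, ‖θ‖ = 1 → |f θ| ≤ C) : Integrable f σ := by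
  have := hσ.isProbabilityMeasure
  exact Integrable.of_bound hf.aestronglyMeasurable C (hσ.norm_eq_one.mono hC)

theorem hasDerivAt_cosTransform (hσ : IsUniformSphereMeasure σ) (u v : V) (ε : ℝ) :
    HasDerivAt (fun ε : ℝ => cosTransform σ (u + ε • v))
      (-∫ θ, Real.sin ⟪θ, u + ε • v⟫ * ⟪θ, v⟫ ∂σ) ε := by
  have h := hasDerivAt_integral_comp_inner_mul (σ := σ) Real.hasDerivAt_cos
    (by fun_prop) Real.abs_cos_le_one (fun x => by simpa using Real.abs_sin_le_one x)
    (g := fun _ => 1) (hσ.integrable_of_abs_le (by fun_prop) 1 (by simp))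
    (hσ.integrable_of_abs_le (by fun_prop) 1 (by simp +contextual)) u v ε
  simpa only [mul_one, neg_mul, integral_neg, cosTransform] using h

theorem hasDerivAt_integral_sin_inner_mul_inner (hσ : IsUniformSphereMeasure σ) (u v w : V)
    (ε : ℝ) :
    HasDerivAt (fun ε : ℝ => ∫ θ, Real.sin ⟪θ, u + ε • v⟫ * ⟪θ, w⟫ ∂σ)
      (∫ θ, Real.cos ⟪θ, u + ε • v⟫ * ⟪θ, v⟫ * ⟪θ, w⟫ ∂σ) ε := by
  refine hasDerivAt_integral_comp_inner_mul Real.hasDerivAt_sin (by fun_prop)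
    Real.abs_sin_le_one Real.abs_cos_le_one
    (hσ.integrable_of_abs_le (by fun_prop) ‖w‖ fun θ hθ => ?_)
    (hσ.integrable_of_abs_le (by fun_prop) ‖w‖ fun θ hθ => ?_) u v ε
  all_goals simpa [hθ] using abs_real_inner_le_norm θ w

end Derivatives

section BesselEquation

variable {σ : Measure V} [BorelSpace V]

theorem integral_sin_inner_mul_inner_eq_zero (hσ : IsUniformSphereMeasure σ) {u v : V}
    (huv : ⟪u, v⟫ = 0) : ∫ θ, Real.sin ⟪θ, u⟫ * ⟪θ, v⟫ ∂σ = 0 := by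
  let L := Submodule.reflection (ℝ ∙ v)ᗮ
  have hu : L u = u := Submodule.reflection_mem_subspace_eq_self
    (Submodule.mem_orthogonal_singleton_iff_inner_right.2 (real_inner_comm u v ▸ huv))
  have hv : L v = -v := Submodule.reflection_orthogonalComplement_singleton_eq_neg v
  have hLu : ∀ θ, ⟪L θ, u⟫ = ⟪θ, u⟫ := fun θ => by rw [← L.inner_map_map θ u, hu]
  have hLv : ∀ θ, ⟪L θ, v⟫ = -⟪θ, v⟫ := fun θ => by
    rw [← L.inner_map_map θ v, hv, inner_neg_right, neg_neg]
  have h := hσ.integral_comp_isometry L fun θ => Real.sin ⟪θ, u⟫ * ⟪θ, v⟫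
  simp only [hLu, hLv, mul_neg, integral_neg] at h
  exact self_eq_neg.1 h.symm

-- Rotating the orthogonal pair `(u, v)` infinitesimally to `(u + ε • v, v - ε • u)` preserves
-- orthogonality, so the identity is the derivative at `ε = 0` of the previous lemma.
theorem integral_cos_inner_mul_inner_sq (hσ : IsUniformSphereMeasure σ) {u v : V}
    (huv : ⟪u, v⟫ = 0) (hnorm : ‖u‖ = ‖v‖) :
    ∫ θ, Real.cos ⟪θ, u⟫ * ⟪θ, v⟫ ^ 2 ∂σ = ∫ θ, Real.sin ⟪θ, u⟫ * ⟪θ, u⟫ ∂σ := by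
  have hint : ∀ a b : V, Integrable (fun θ => Real.sin ⟪θ, a⟫ * ⟪θ, b⟫) σ := fun a b =>
    hσ.integrable_of_abs_le (by fun_prop) ‖b‖ fun θ hθ => by
      rw [abs_mul]
      have h := abs_real_inner_le_norm θ b
      rw [hθ, one_mul] at h
      exact (mul_le_of_le_one_left (abs_nonneg _) (Real.abs_sin_le_one _)).trans h
  have hzero : ∀ ε : ℝ, ∫ θ, Real.sin ⟪θ, u + ε • v⟫ * ⟪θ, v⟫ ∂σ
      - ε * ∫ θ, Real.sin ⟪θ, u + ε • v⟫ * ⟪θ, u⟫ ∂σ = 0 := by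
    intro ε
    have horth : ⟪u + ε • v, v - ε • u⟫ = 0 := by
      simp only [inner_sub_right, inner_add_left, real_inner_smul_left, real_inner_smul_right,
        real_inner_comm u v, huv, real_inner_self_eq_norm_sq, hnorm]
      ring
    rw [← hσ.integral_sin_inner_mul_inner_eq_zero horth, ← integral_const_mul,
      ← integral_sub (hint _ _) ((hint _ _).const_mul _)]
    congr 1 with θ
    rw [inner_sub_right, real_inner_smul_right]
    ring
  have hderiv := (hσ.hasDerivAt_integral_sin_inner_mul_inner u v v 0).sub
    ((hasDerivAt_id 0).mul (hσ.hasDerivAt_integral_sin_inner_mul_inner u v u 0))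
  have h := hderiv.unique ((hasDerivAt_const (0 : ℝ) (0 : ℝ)).congr_of_eventuallyEq
    (Eventually.of_forall hzero))
  simp only [zero_smul, add_zero, id_eq, one_mul, zero_mul, mul_assoc, ← pow_two] at h
  exact sub_eq_zero.1 h

theorem integral_cos_mul_inner_sq_add (hσ : IsUniformSphereMeasure σ) {ι : Type*} [Fintype ι]
    (b : OrthonormalBasis ι ℝ V) (i : ι) {s : ℝ} (hs : s ≠ 0) :
    ∫ θ, Real.cos ⟪θ, s • b i⟫ * ⟪θ, b i⟫ ^ 2 ∂σ = cosTransform σ (s • b i) -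
      (Fintype.card ι - 1) / s * ∫ θ, Real.sin ⟪θ, s • b i⟫ * ⟪θ, b i⟫ ∂σ := by
  classical
  let K : ι → ℝ := fun j => ∫ θ, Real.cos ⟪θ, s • b i⟫ * ⟪θ, b j⟫ ^ 2 ∂σ
  have hK : ∀ j ∈ Finset.univ.erase i,
      K j = s⁻¹ * ∫ θ, Real.sin ⟪θ, s • b i⟫ * ⟪θ, b i⟫ ∂σ := by
    intro j hj
    have horth : ⟪s • b i, s • b j⟫ = 0 := by
      rw [real_inner_smul_left, real_inner_smul_right,
        b.inner_eq_zero (Finset.ne_of_mem_erase hj).symm, mul_zero, mul_zero]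
    have h := hσ.integral_cos_inner_mul_inner_sq horth (by simp [norm_smul])
    have hl : ∀ θ, Real.cos ⟪θ, s • b i⟫ * ⟪θ, s • b j⟫ ^ 2
        = s ^ 2 * (Real.cos ⟪θ, s • b i⟫ * ⟪θ, b j⟫ ^ 2) := fun θ => by
      rw [real_inner_smul_right θ (b j)]; ring
    have hr : ∀ θ, Real.sin ⟪θ, s • b i⟫ * ⟪θ, s • b i⟫
        = s * (Real.sin ⟪θ, s • b i⟫ * ⟪θ, b i⟫) := fun θ => by
      rw [real_inner_smul_right θ (b i)]; ring
    simp only [hl, hr, integral_const_mul] at h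
    rw [eq_inv_mul_iff_mul_eq₀ hs]
    exact mul_left_cancel₀ hs (by rw [← mul_assoc, ← pow_two]; exact h)
  have hsum : ∑ j, K j = cosTransform σ (s • b i) := by
    rw [← integral_finsetSum]
    · refine integral_congr_ae (hσ.norm_eq_one.mono fun θ hθ => ?_)
      simp only [← Finset.mul_sum, b.sum_sq_inner_left, hθ, one_pow, mul_one]
    · refine fun j _ => hσ.integrable_of_abs_le (by fun_prop) 1 fun θ hθ => ?_
      have h : |⟪θ, b j⟫| ≤ 1 := by simpa [hθ] using abs_real_inner_le_norm θ (b j)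
      rw [abs_mul, abs_pow]
      exact mul_le_one₀ (Real.abs_cos_le_one _) (by positivity) (pow_le_one₀ (abs_nonneg _) h)
  have hcard : ((Finset.univ.erase i).card : ℝ) = Fintype.card ι - 1 := by
    rw [Finset.card_erase_of_mem (Finset.mem_univ i), Finset.card_univ,
      Nat.cast_pred (Fintype.card_pos_iff.2 ⟨i⟩)]
  rw [← hsum, ← Finset.add_sum_erase _ _ (Finset.mem_univ i), Finset.sum_congr rfl hK,
    Finset.sum_const, nsmul_eq_mul, hcard]
  ring

end BesselEquation

end IsUniformSphereMeasure

end SphereMeasure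

/-! ### Decay of the spherical Fourier transform -/

-- `(h ^ 2 + h₁ ^ 2) * exp (|N| / s)` is a decreasing Lyapunov function.
theorem exists_abs_le_of_perturbed_oscillator {N : ℝ} {h h₁ : ℝ → ℝ}
    (hh : ∀ s, 0 < s → HasDerivAt h (h₁ s) s)
    (hh₁ : ∀ s, 0 < s → HasDerivAt h₁ ((N / s ^ 2 - 1) * h s) s) :
    ∃ C, ∀ s, 1 ≤ s → |h s| ≤ C := by
  let W : ℝ → ℝ := fun s => (h s ^ 2 + h₁ s ^ 2) * Real.exp (|N| / s)
  let W' : ℝ → ℝ := fun s =>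
    (2 * N * (h s * h₁ s) - |N| * (h s ^ 2 + h₁ s ^ 2)) / s ^ 2 * Real.exp (|N| / s)
  have hW : ∀ s, 0 < s → HasDerivAt W (W' s) s := by
    intro s hs
    have hexp := ((hasDerivAt_const s |N|).div (hasDerivAt_id s) hs.ne').exp
    refine ((((hh s hs).pow 2).add ((hh₁ s hs).pow 2)).mul hexp).congr_deriv ?_
    simp only [W', Pi.add_apply, Pi.pow_apply, Pi.div_apply, id]
    field_simp
    ring
  have hW' : ∀ s, W' s ≤ 0 := by
    intro s
    have hamgm : |2 * (h s * h₁ s)| ≤ h s ^ 2 + h₁ s ^ 2 := by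
      rw [abs_le]
      constructor <;> nlinarith [sq_nonneg (h s + h₁ s), sq_nonneg (h s - h₁ s)]
    have hle : 2 * N * (h s * h₁ s) ≤ |N| * (h s ^ 2 + h₁ s ^ 2) :=
      calc 2 * N * (h s * h₁ s) = N * (2 * (h s * h₁ s)) := by ring
        _ ≤ |N| * |2 * (h s * h₁ s)| := (le_abs_self _).trans_eq (abs_mul _ _)
        _ ≤ |N| * (h s ^ 2 + h₁ s ^ 2) := by gcongr
    exact mul_nonpos_of_nonpos_of_nonneg
      (div_nonpos_of_nonpos_of_nonneg (sub_nonpos.2 hle) (sq_nonneg s)) (Real.exp_nonneg _)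
  have hanti : AntitoneOn W (Set.Ici 1) :=
    antitoneOn_of_hasDerivWithinAt_nonpos (convex_Ici 1)
      (fun s hs => (hW s (one_pos.trans_le hs)).continuousAt.continuousWithinAt)
      (fun s hs => (hW s (one_pos.trans_le (interior_subset hs))).hasDerivWithinAt)
      (fun s _ => hW' s)
  refine ⟨√(W 1), fun s hs => Real.abs_le_sqrt ?_⟩
  calc h s ^ 2 ≤ h s ^ 2 + h₁ s ^ 2 := le_add_of_nonneg_right (sq_nonneg _)
    _ ≤ W s := le_mul_of_one_le_right (by positivity) (Real.one_le_exp (by positivity))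
    _ ≤ W 1 := hanti Set.self_mem_Ici hs hs

-- The substitution `h = s ^ (m / 2) * g` removes the damping term.
theorem exists_abs_le_rpow_of_damped_oscillator {m : ℝ} {g g₁ : ℝ → ℝ}
    (hg : ∀ s, 0 < s → HasDerivAt g (g₁ s) s)
    (hg₁ : ∀ s, 0 < s → HasDerivAt g₁ (-g s - m / s * g₁ s) s) :
    ∃ C, ∀ s, 1 ≤ s → |g s| ≤ C * s ^ (-(m / 2)) := by
  let p : ℝ → ℝ := fun s => s ^ (m / 2)
  have hp : ∀ s, 0 < s → HasDerivAt p (m / 2 / s * p s) s := by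
    intro s hs
    refine (Real.hasDerivAt_rpow_const (Or.inl hs.ne')).congr_deriv ?_
    rw [Real.rpow_sub_one hs.ne']
    ring
  have hdiv : ∀ s : ℝ, 0 < s → HasDerivAt (fun s => m / 2 / s) (-(m / 2) / s ^ 2) s := by
    intro s hs
    refine ((hasDerivAt_const s (m / 2)).div (hasDerivAt_id s) hs.ne').congr_deriv ?_
    simp
  obtain ⟨C, hC⟩ := exists_abs_le_of_perturbed_oscillator (N := m / 2 * (m / 2 - 1))
    (h := fun s => p s * g s) (h₁ := fun s => p s * (g₁ s + m / 2 / s * g s))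
    (fun s hs => ((hp s hs).mul (hg s hs)).congr_deriv (by ring))
    (fun s hs => ((hp s hs).mul ((hg₁ s hs).add ((hdiv s hs).mul (hg s hs)))).congr_deriv (by
      simp only [Pi.add_apply, Pi.mul_apply]
      field_simp
      ring))
  refine ⟨C, fun s hs => ?_⟩
  have hs₀ : 0 < s := one_pos.trans_le hs
  have h := hC s hs
  rw [abs_mul, abs_of_pos (Real.rpow_pos_of_pos hs₀ _)] at h
  rwa [Real.rpow_neg hs₀.le, ← div_eq_mul_inv, le_div_iff₀' (Real.rpow_pos_of_pos hs₀ _)]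

section Decay

variable {V : Type*} [NormedAddCommGroup V] [InnerProductSpace ℝ V] [MeasurableSpace V]
  [BorelSpace V]

namespace IsUniformSphereMeasure

variable {σ : Measure V} [FiniteDimensional ℝ V]

theorem exists_abs_cosTransform_le [Nontrivial V] (hσ : IsUniformSphereMeasure σ) :
    ∃ C : ℝ, 0 < C ∧
      ∀ ξ, ξ ≠ 0 → |cosTransform σ ξ| ≤ C * ‖ξ‖ ^ (-(((Module.finrank ℝ V : ℝ) - 1) / 2)) := by
  have := hσ.isProbabilityMeasure
  let b := stdOrthonormalBasis ℝ V
  let i : Fin (Module.finrank ℝ V) := ⟨0, Module.finrank_pos⟩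
  obtain ⟨C, hC⟩ := exists_abs_le_rpow_of_damped_oscillator (m := Module.finrank ℝ V - 1)
    (g := fun s => cosTransform σ (s • b i))
    (g₁ := fun s => -∫ θ, Real.sin ⟪θ, s • b i⟫ * ⟪θ, b i⟫ ∂σ)
    (fun s _ => by simpa only [zero_add] using hσ.hasDerivAt_cosTransform 0 (b i) s)
    (fun s hs => by
      have h := (hσ.hasDerivAt_integral_sin_inner_mul_inner 0 (b i) (b i) s).neg
      simp only [zero_add, mul_assoc, ← pow_two] at h
      rw [hσ.integral_cos_mul_inner_sq_add b i hs.ne', Fintype.card_fin] at h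
      exact h.congr_deriv (by ring))
  refine ⟨max 1 C, by positivity, fun ξ hξ => ?_⟩
  have hξ' : 0 < ‖ξ‖ := norm_pos_iff.2 hξ
  rcases le_total 1 ‖ξ‖ with h | h
  · rw [hσ.cosTransform_eq_of_norm_eq (η := ‖ξ‖ • b i) (by simp [norm_smul])]
    exact (hC ‖ξ‖ h).trans (by gcongr; exact le_max_right _ _)
  · have hdim : (1 : ℝ) ≤ Module.finrank ℝ V := mod_cast Module.finrank_pos
    refine (abs_cosTransform_le_one ξ).trans (one_le_mul_of_one_le_of_one_le (le_max_left _ _) ?_)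
    exact Real.one_le_rpow_of_pos_of_le_one_of_nonpos hξ' h (by linarith)

theorem tendsto_cosTransform_cocompact (hσ : IsUniformSphereMeasure σ)
    (hV : 1 < Module.finrank ℝ V) : Tendsto (cosTransform σ) (cocompact V) (𝓝 0) := by
  have : Nontrivial V := Module.nontrivial_of_finrank_pos (one_pos.trans hV)
  obtain ⟨C, -, hC⟩ := hσ.exists_abs_cosTransform_le
  have hdim : 0 < ((Module.finrank ℝ V : ℝ) - 1) / 2 := by
    have : (1 : ℝ) < Module.finrank ℝ V := mod_cast hV
    linarith
  have hlim := (((tendsto_rpow_neg_atTop hdim).const_mul C).comp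
    (tendsto_norm_cocompact_atTop (E := V)))
  rw [mul_zero] at hlim
  refine squeeze_zero_norm' ?_ hlim
  filter_upwards [(isCompact_singleton (x := (0 : V))).compl_mem_cocompact] with ξ hξ
  exact hC ξ hξ

end IsUniformSphereMeasure

end Decay

/-! ### A lower bound for the spherical Fourier transform -/

section EquilateralTriangle

variable {V : Type*} [NormedAddCommGroup V] [InnerProductSpace ℝ V]

theorem exists_equilateral_triangle [FiniteDimensional ℝ V] (hV : 1 < Module.finrank ℝ V)
    {s : ℝ} (hs : 0 ≤ s) : ∃ ξ η : V, ‖ξ‖ = s ∧ ‖η‖ = s ∧ ‖ξ - η‖ = s := by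
  let b := stdOrthonormalBasis ℝ V
  let e := b ⟨0, one_pos.trans hV⟩
  let f := b ⟨1, hV⟩
  have hef : ⟪e, f⟫ = 0 := b.inner_eq_zero (by simp)
  have hnorm : ∀ x y : ℝ, x ^ 2 + y ^ 2 = s ^ 2 → ‖x • e + y • f‖ = s := by
    intro x y hxy
    have horth : ⟪x • e, y • f⟫ = 0 := by
      rw [real_inner_smul_left, real_inner_smul_right, hef, mul_zero, mul_zero]
    rw [← sq_eq_sq₀ (norm_nonneg _) hs, sq, norm_add_sq_eq_norm_sq_add_norm_sq_real horth, ← hxy]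
    simp [e, f, norm_smul, ← sq]
  have h3 : √3 ^ 2 = (3 : ℝ) := Real.sq_sqrt (by norm_num)
  refine ⟨s • e, (s / 2) • e + (s * √3 / 2) • f, ?_, hnorm _ _ ?_, ?_⟩
  · simpa using hnorm s 0 (by ring)
  · linear_combination s ^ 2 / 4 * h3
  · rw [show s • e - ((s / 2) • e + (s * √3 / 2) • f) = (s / 2) • e + (-(s * √3 / 2)) • f by module]
    exact hnorm _ _ (by linear_combination s ^ 2 / 4 * h3)

end EquilateralTriangle

theorem one_add_cos_add_cos_sq_add (a b : ℝ) :
    (1 + Real.cos a + Real.cos b) ^ 2 + (Real.sin a + Real.sin b) ^ 2 =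
      3 + 2 * (Real.cos a + Real.cos b + Real.cos (a - b)) := by
  rw [Real.cos_sub]
  linear_combination Real.sin_sq_add_cos_sq a + Real.sin_sq_add_cos_sq b

theorem cos_eq_neg_half_of_cos_add_cos_add_cos {a b : ℝ}
    (h : 3 + 2 * (Real.cos a + Real.cos b + Real.cos (a - b)) = 0) : Real.cos a = -(1 / 2) := by
  rw [← one_add_cos_add_cos_sq_add] at h
  have hcos : 1 + Real.cos a + Real.cos b = 0 := by
    rw [← sq_eq_zero_iff]; exact (add_eq_zero_iff_of_nonneg (sq_nonneg _) (sq_nonneg _)).1 h |>.1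
  have hsin : Real.sin a + Real.sin b = 0 := by
    rw [← sq_eq_zero_iff]; exact (add_eq_zero_iff_of_nonneg (sq_nonneg _) (sq_nonneg _)).1 h |>.2
  linear_combination (Real.sin_sq_add_cos_sq b - Real.sin_sq_add_cos_sq a +
    (1 + Real.cos a - Real.cos b) * hcos + (Real.sin a - Real.sin b) * hsin) / 2

section LowerBound

variable {V : Type*} [NormedAddCommGroup V] [InnerProductSpace ℝ V] [MeasurableSpace V]
  [BorelSpace V]

namespace IsUniformSphereMeasure

variable {σ : Measure V}

theorem one_sub_sq_norm_div_two_le_cosTransform (hσ : IsUniformSphereMeasure σ) (ξ : V) :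
    1 - ‖ξ‖ ^ 2 / 2 ≤ cosTransform σ ξ := by
  have := hσ.isProbabilityMeasure
  calc 1 - ‖ξ‖ ^ 2 / 2 = ∫ _, (1 - ‖ξ‖ ^ 2 / 2) ∂σ := by simp
    _ ≤ cosTransform σ ξ := by
      refine integral_mono_ae (integrable_const _) (integrable_cos_inner ξ) ?_
      filter_upwards [hσ.norm_eq_one] with θ hθ
      have hθξ : |⟪θ, ξ⟫| ≤ ‖ξ‖ := by simpa [hθ] using abs_real_inner_le_norm θ ξ
      have hsq : ⟪θ, ξ⟫ ^ 2 ≤ ‖ξ‖ ^ 2 := sq_le_sq' (neg_le_of_abs_le hθξ) (le_of_abs_le hθξ)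
      linarith [Real.one_sub_sq_div_two_le_cos (x := ⟪θ, ξ⟫)]

theorem integral_equilateral (hσ : IsUniformSphereMeasure σ) {ξ η : V}
    (hη : ‖η‖ = ‖ξ‖) (hξη : ‖ξ - η‖ = ‖ξ‖) :
    ∫ θ, (3 + 2 * (Real.cos ⟪θ, ξ⟫ + Real.cos ⟪θ, η⟫ + Real.cos (⟪θ, ξ⟫ - ⟪θ, η⟫))) ∂σ =
      3 + 6 * cosTransform σ ξ := by
  have := hσ.isProbabilityMeasure
  have hint := integrable_cos_inner (σ := σ)
  simp only [← inner_sub_right]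
  rw [integral_add (integrable_const _)
      ((((hint ξ).fun_add (hint η)).fun_add (hint (ξ - η))).const_mul 2),
    integral_const_mul, integral_add ((hint ξ).fun_add (hint η)) (hint (ξ - η)),
    integral_add (hint ξ) (hint η)]
  have h₁ := hσ.cosTransform_eq_of_norm_eq hη
  have h₂ := hσ.cosTransform_eq_of_norm_eq hξη
  simp only [cosTransform] at h₁ h₂ ⊢
  rw [h₁, h₂, integral_const, probReal_univ, one_smul]
  ring

variable [FiniteDimensional ℝ V]

theorem neg_half_le_cosTransform (hσ : IsUniformSphereMeasure σ) (hV : 1 < Module.finrank ℝ V)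
    (ζ : V) : -(1 / 2) ≤ cosTransform σ ζ := by
  obtain ⟨ξ, η, hξ, hη, hξη⟩ := exists_equilateral_triangle hV (norm_nonneg ζ)
  have hnonneg : 0 ≤ 3 + 6 * cosTransform σ ξ := by
    rw [← hσ.integral_equilateral (hη.trans hξ.symm) (hξη.trans hξ.symm)]
    refine integral_nonneg fun θ => ?_
    rw [Pi.zero_apply, ← one_add_cos_add_cos_sq_add]
    positivity
  rw [← hσ.cosTransform_eq_of_norm_eq hξ]
  linarith

theorem cosTransform_two_smul_eq_neg_half (hσ : IsUniformSphereMeasure σ)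
    (hV : 1 < Module.finrank ℝ V) {ζ : V} (hζ : cosTransform σ ζ = -(1 / 2)) :
    cosTransform σ ((2 : ℝ) • ζ) = -(1 / 2) := by
  have := hσ.isProbabilityMeasure
  obtain ⟨ξ, η, hξ, hη, hξη⟩ := exists_equilateral_triangle hV (norm_nonneg ζ)
  have hzero := hσ.integral_equilateral (hη.trans hξ.symm) (hξη.trans hξ.symm)
  have hint := integrable_cos_inner (σ := σ)
  rw [hσ.cosTransform_eq_of_norm_eq hξ, hζ, show (3 : ℝ) + 6 * -(1 / 2) = 0 by norm_num,
    integral_eq_zero_iff_of_nonneg (fun θ => by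
      rw [Pi.zero_apply, ← one_add_cos_add_cos_sq_add]; positivity)] at hzero
  · have hcos : ∀ᵐ θ ∂σ, Real.cos ⟪θ, (2 : ℝ) • ξ⟫ = -(1 / 2) := by
      filter_upwards [hzero] with θ hθ
      rw [real_inner_smul_right, Real.cos_two_mul, cos_eq_neg_half_of_cos_add_cos_add_cos hθ]
      norm_num
    rw [hσ.cosTransform_eq_of_norm_eq (η := (2 : ℝ) • ξ) (by simp [norm_smul, hξ]), cosTransform,
      integral_congr_ae hcos, integral_const, probReal_univ, one_smul]
  · simp only [← inner_sub_right]
    exact (integrable_const _).add ((((hint ξ).add (hint η)).add (hint (ξ - η))).const_mul 2)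

theorem neg_half_lt_cosTransform (hσ : IsUniformSphereMeasure σ) (hV : 1 < Module.finrank ℝ V)
    (ζ : V) : -(1 / 2) < cosTransform σ ζ := by
  refine lt_of_le_of_ne (hσ.neg_half_le_cosTransform hV ζ) fun h => ?_
  have := hσ.isProbabilityMeasure
  have hζ : ζ ≠ 0 := by
    rintro rfl
    norm_num [cosTransform] at h
  have hpow : ∀ n : ℕ, cosTransform σ ((2 : ℝ) ^ n • ζ) = -(1 / 2) := by
    intro n
    induction n with
    | zero => simpa using h.symm
    | succ n ih => rw [pow_succ', mul_smul]; exact hσ.cosTransform_two_smul_eq_neg_half hV ih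
  have hescape : Tendsto (fun n : ℕ => (2 : ℝ) ^ n • ζ) atTop (cocompact V) := by
    rw [← Metric.cobounded_eq_cocompact, ← tendsto_norm_atTop_iff_cobounded]
    simpa [norm_smul] using
      (tendsto_pow_atTop_atTop_of_one_lt one_lt_two).atTop_mul_const (norm_pos_iff.2 hζ)
  have hlim := (hσ.tendsto_cosTransform_cocompact hV).comp hescape
  simp only [Function.comp_def, hpow] at hlim
  exact absurd (tendsto_nhds_unique tendsto_const_nhds hlim) (by norm_num)

theorem exists_neg_le_cosTransform (hσ : IsUniformSphereMeasure σ)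
    (hV : 1 < Module.finrank ℝ V) :
    ∃ κ : ℝ, 0 < κ ∧ κ < 1 / 2 ∧ ∀ ξ, -κ ≤ cosTransform σ ξ := by
  have := hσ.isProbabilityMeasure
  have hcont : Continuous fun ξ => min (cosTransform σ ξ) (-(1 / 4)) :=
    continuous_cosTransform.min continuous_const
  obtain ⟨ξ₀, hξ₀⟩ := hcont.exists_forall_le' (0 : V) <| by
    filter_upwards [(hσ.tendsto_cosTransform_cocompact hV).eventually
      (lt_mem_nhds (by norm_num : -(1 / 4) < (0 : ℝ)))] with ξ hξ
    rw [min_eq_right hξ.le]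
    exact min_le_right _ _
  refine ⟨-min (cosTransform σ ξ₀) (-(1 / 4)), ?_, ?_, fun ξ => ?_⟩
  · linarith [min_le_right (cosTransform σ ξ₀) (-(1 / 4))]
  · rw [neg_lt, lt_min_iff]
    exact ⟨hσ.neg_half_lt_cosTransform hV ξ₀, by norm_num⟩
  · rw [neg_neg]
    exact (hξ₀ ξ).trans (min_le_left _ _)

end IsUniformSphereMeasure

end LowerBound

/-! ### Measures vanishing near the origin -/

theorem ae_conv {M : Type*} [AddMonoid M] [MeasurableSpace M] [MeasurableAdd₂ M]
    {α β : Measure M} {p q r : M → Prop} (hr : MeasurableSet {z | r z})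
    (hα : ∀ᵐ x ∂α, p x) (hβ : ∀ᵐ y ∂β, q y)
    (h : ∀ x y, p x → q y → r (x + y)) : ∀ᵐ z ∂(α ∗ β), r z := by
  rw [Measure.conv, ae_map_iff (by fun_prop) hr]
  filter_upwards [Measure.quasiMeasurePreserving_fst.ae hα,
    Measure.quasiMeasurePreserving_snd.ae hβ] with z hx hy
  exact h _ _ hx hy

section FourierSupport

variable {V : Type*} [NormedAddCommGroup V] [InnerProductSpace ℝ V] [MeasurableSpace V]
  [BorelSpace V]

section Gaussian

variable [FiniteDimensional ℝ V] {b : ℝ}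

theorem integrable_exp_neg_mul_sq_norm (hb : 0 < b) :
    Integrable fun ξ : V => Real.exp (-b * ‖ξ‖ ^ 2) := by
  have h := (GaussianFourier.integrable_cexp_neg_mul_sq_norm_add (b := (b : ℂ)) (by simpa using hb)
    0 (0 : V)).norm
  simpa [Complex.norm_exp, ← Complex.ofReal_pow] using h

theorem integral_charFun_mul_exp_neg_mul_sq_norm (ρ : Measure V) [IsFiniteMeasure ρ] (hb : 0 < b) :
    ∫ ξ, charFun ρ ξ * Real.exp (-b * ‖ξ‖ ^ 2) =
      ((Real.pi / b) ^ (Module.finrank ℝ V / 2 : ℝ) *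
        ∫ z, Real.exp (-‖z‖ ^ 2 / (4 * b)) ∂ρ : ℝ) := by
  have hprod : Integrable (Function.uncurry fun (ξ z : V) =>
      Complex.exp (-(b : ℂ) * (‖ξ‖ : ℂ) ^ 2 + Complex.I * (⟪z, ξ⟫ : ℝ))) (volume.prod ρ) := by
    refine ((integrable_exp_neg_mul_sq_norm hb).comp_fst ρ).mono'
      (Continuous.aestronglyMeasurable (by fun_prop)) (Eventually.of_forall fun p => ?_)
    simp [Function.uncurry, Complex.norm_exp, ← Complex.ofReal_pow]
  calc ∫ ξ, charFun ρ ξ * Real.exp (-b * ‖ξ‖ ^ 2)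
      = ∫ ξ, ∫ z, Complex.exp (-(b : ℂ) * (‖ξ‖ : ℂ) ^ 2 + Complex.I * (⟪z, ξ⟫ : ℝ)) ∂ρ := by
        congr 1 with ξ
        rw [charFun_apply, ← integral_mul_const]
        congr 1 with z
        rw [Complex.exp_add, mul_comm, mul_comm Complex.I]
        push_cast
        rfl
    _ = ∫ z, (∫ ξ, Complex.exp (-(b : ℂ) * (‖ξ‖ : ℂ) ^ 2 + Complex.I * (⟪z, ξ⟫ : ℝ))) ∂ρ :=
        integral_integral_swap hprod
    _ = ∫ z, (((Real.pi / b) ^ (Module.finrank ℝ V / 2 : ℝ) *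
          Real.exp (-‖z‖ ^ 2 / (4 * b)) : ℝ) : ℂ) ∂ρ := by
        congr 1 with z
        rw [GaussianFourier.integral_cexp_neg_mul_sq_norm_add (by simpa using hb), Complex.I_sq,
          Complex.ofReal_mul, Complex.ofReal_cpow (by positivity)]
        push_cast
        ring_nf
    _ = _ := by rw [integral_complex_ofReal, integral_const_mul]

theorem tendsto_integral_mul_exp_neg_mul_sq_norm {f : V → ℂ} (hf : Integrable f) :
    Tendsto (fun b : ℝ => ∫ ξ, f ξ * Real.exp (-b * ‖ξ‖ ^ 2)) (𝓝[>] 0) (𝓝 (∫ ξ, f ξ)) := by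
  refine tendsto_integral_filter_of_dominated_convergence (fun ξ => ‖f ξ‖)
    (Eventually.of_forall fun b => hf.aestronglyMeasurable.mul
      (Continuous.aestronglyMeasurable (by fun_prop))) ?_ hf.norm
    (Eventually.of_forall fun ξ => ?_)
  · filter_upwards [self_mem_nhdsWithin] with b (hb : 0 < b)
    refine Eventually.of_forall fun ξ => ?_
    rw [norm_mul, Complex.norm_real, Real.norm_of_nonneg (Real.exp_nonneg _)]
    refine mul_le_of_le_one_right (norm_nonneg _) (Real.exp_le_one_iff.2 ?_)
    rw [neg_mul, neg_nonpos]
    positivity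
  · have hcont : Continuous fun b : ℝ => f ξ * Real.exp (-b * ‖ξ‖ ^ 2) := by fun_prop
    simpa using (hcont.tendsto 0).mono_left nhdsWithin_le_nhds

theorem integral_charFun_eq_zero {ρ : Measure V} [IsFiniteMeasure ρ] {r : ℝ} (hr : 0 < r)
    (hρ : ∀ᵐ z ∂ρ, r ≤ ‖z‖) (hint : Integrable (charFun ρ)) : ∫ ξ, charFun ρ ξ = 0 := by
  refine tendsto_nhds_unique (tendsto_integral_mul_exp_neg_mul_sq_norm hint) ?_
  let p : ℝ := Module.finrank ℝ V / 2
  have hdecay : Tendsto (fun b : ℝ => Real.pi ^ p * ρ.real Set.univ *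
      (b⁻¹ ^ p * Real.exp (-(r ^ 2 / 4) * b⁻¹))) (𝓝[>] 0) (𝓝 0) := by
    simpa [Function.comp_def] using ((tendsto_rpow_mul_exp_neg_mul_atTop_nhds_zero p (r ^ 2 / 4)
      (by positivity)).const_mul (Real.pi ^ p * ρ.real Set.univ)).comp tendsto_inv_nhdsGT_zero
  refine squeeze_zero_norm' ?_ hdecay
  filter_upwards [self_mem_nhdsWithin] with b (hb : 0 < b)
  have hexp : ‖∫ z, Real.exp (-‖z‖ ^ 2 / (4 * b)) ∂ρ‖ ≤
      Real.exp (-(r ^ 2 / 4) * b⁻¹) * ρ.real Set.univ := by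
    refine norm_integral_le_of_norm_le_const (hρ.mono fun z hz => ?_)
    rw [Real.norm_of_nonneg (Real.exp_nonneg _), Real.exp_le_exp,
      show -‖z‖ ^ 2 / (4 * b) = -(‖z‖ ^ 2 / 4) * b⁻¹ by field_simp]
    gcongr
  rw [integral_charFun_mul_exp_neg_mul_sq_norm ρ hb, Complex.norm_real, norm_mul,
    div_eq_mul_inv, Real.mul_rpow Real.pi_pos.le (by positivity),
    Real.norm_of_nonneg (by positivity)]
  calc _ ≤ Real.pi ^ p * b⁻¹ ^ p * (Real.exp (-(r ^ 2 / 4) * b⁻¹) * ρ.real Set.univ) := by gcongr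
    _ = _ := by ring

end Gaussian

section Autocorrelation

variable [SecondCountableTopology V]

/-- The law of `x - y` for `x` and `y` drawn independently from `ν`; its Fourier transform is
`|ν̂|²`. -/
noncomputable def autocorrelation (ν : Measure V) : Measure V :=
  (ν.prod ν).map fun p => p.1 - p.2

instance (ν : Measure V) [IsFiniteMeasure ν] : IsFiniteMeasure (autocorrelation ν) :=
  Measure.isFiniteMeasure_map _ _

theorem charFun_autocorrelation (ν : Measure V) [IsFiniteMeasure ν] (ξ : V) :
    charFun (autocorrelation ν) ξ = ((‖charFun ν ξ‖ ^ 2 : ℝ) : ℂ) := by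
  rw [← Complex.normSq_eq_norm_sq, ← Complex.mul_conj, ← charFun_neg, charFun_apply,
    autocorrelation, integral_map (by fun_prop) (Continuous.aestronglyMeasurable (by fun_prop)),
    charFun_apply, charFun_apply, ← integral_prod_mul]
  congr 1 with p
  rw [← Complex.exp_add, inner_sub_left, inner_neg_right]
  push_cast
  ring_nf

end Autocorrelation

end FourierSupport

/-! ### Riesz energies -/

section RieszEnergy

theorem ofReal_rpow_neg_eq_lintegral_gaussian {a r : ℝ} (ha : 0 < a) (hr : 0 < r) :
    ENNReal.ofReal (r ^ (-a)) = ∫⁻ b in Set.Ioi (0 : ℝ),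
      ENNReal.ofReal ((Real.Gamma (a / 2))⁻¹ * b ^ (a / 2 - 1)) *
        ENNReal.ofReal (Real.exp (-b * r ^ 2)) := by
  have hΓ : 0 < Real.Gamma (a / 2) := Real.Gamma_pos_of_pos (by positivity)
  have hgamma : ∫ b in Set.Ioi (0 : ℝ),
      (Real.Gamma (a / 2))⁻¹ * (b ^ (a / 2 - 1) * Real.exp (-(r ^ 2 * b))) = r ^ (-a) := by
    rw [integral_const_mul, Real.integral_rpow_mul_exp_neg_mul_Ioi (by positivity) (by positivity),
      mul_comm, mul_assoc, mul_inv_cancel₀ hΓ.ne', mul_one, one_div, Real.inv_rpow (by positivity),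
      ← Real.rpow_natCast, ← Real.rpow_mul hr.le, Real.rpow_neg hr.le]
    congr 2
    push_cast
    ring
  have hint : IntegrableOn (fun b : ℝ =>
      (Real.Gamma (a / 2))⁻¹ * (b ^ (a / 2 - 1) * Real.exp (-(r ^ 2 * b)))) (Set.Ioi 0) :=
    not_not.1 fun h => (Real.rpow_pos_of_pos hr (-a)).ne' (hgamma ▸ integral_undef h)
  rw [← hgamma, ofReal_integral_eq_lintegral_ofReal hint
    ((ae_restrict_iff' measurableSet_Ioi).2 (Eventually.of_forall fun b (hb : 0 < b) => by
      positivity))]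
  refine setLIntegral_congr_fun measurableSet_Ioi fun b (hb : 0 < b) => ?_
  rw [← ENNReal.ofReal_mul (by positivity)]
  ring_nf

variable {V : Type*} [NormedAddCommGroup V] [InnerProductSpace ℝ V] [MeasurableSpace V]
  [BorelSpace V] {a : ℝ}

/-- The positive function with Fourier transform `|ξ|^(-a)`, encoded as a superposition of
Gaussians; for `0 < a < dim V` it is a multiple of `|z|^(a - dim V)`. -/
noncomputable def rieszKernel (a : ℝ) (z : V) : ℝ≥0∞ :=
  ∫⁻ b in Set.Ioi (0 : ℝ), ENNReal.ofReal ((Real.Gamma (a / 2))⁻¹ * b ^ (a / 2 - 1)) *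
    ENNReal.ofReal ((Real.pi / b) ^ (Module.finrank ℝ V / 2 : ℝ) * Real.exp (-‖z‖ ^ 2 / (4 * b)))

theorem measurable_rieszKernel : Measurable (rieszKernel a : V → ℝ≥0∞) :=
  Measurable.lintegral_prod_right' (f := fun p : V × ℝ =>
    ENNReal.ofReal ((Real.Gamma (a / 2))⁻¹ * p.2 ^ (a / 2 - 1)) *
      ENNReal.ofReal ((Real.pi / p.2) ^ (Module.finrank ℝ V / 2 : ℝ) *
        Real.exp (-‖p.1‖ ^ 2 / (4 * p.2)))) (by fun_prop)

variable [FiniteDimensional ℝ V]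

theorem lintegral_enorm_charFun_sq_mul_gaussian (ν : Measure V) [IsFiniteMeasure ν] {b : ℝ}
    (hb : 0 < b) :
    ∫⁻ ξ, ‖charFun ν ξ‖ₑ ^ 2 * ENNReal.ofReal (Real.exp (-b * ‖ξ‖ ^ 2)) =
      ∫⁻ z, ENNReal.ofReal ((Real.pi / b) ^ (Module.finrank ℝ V / 2 : ℝ) *
        Real.exp (-‖z‖ ^ 2 / (4 * b))) ∂autocorrelation ν := by
  have hgauss : Integrable fun ξ : V => ‖charFun ν ξ‖ ^ 2 * Real.exp (-b * ‖ξ‖ ^ 2) := by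
    refine (integrable_exp_neg_mul_sq_norm hb).bdd_mul
      (c := ν.real Set.univ ^ 2) (Measurable.aestronglyMeasurable (by fun_prop))
      (Eventually.of_forall fun ξ => ?_)
    rw [norm_pow, norm_norm]
    gcongr
    exact norm_charFun_le ξ
  have hexp : Integrable (fun z : V => (Real.pi / b) ^ (Module.finrank ℝ V / 2 : ℝ) *
      Real.exp (-‖z‖ ^ 2 / (4 * b))) (autocorrelation ν) := by
    refine Integrable.const_mul (Integrable.of_bound (C := 1)
      (Continuous.aestronglyMeasurable (by fun_prop)) (Eventually.of_forall fun z => ?_)) _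
    rw [Real.norm_of_nonneg (Real.exp_nonneg _), Real.exp_le_one_iff, neg_div, neg_nonpos]
    positivity
  rw [← ofReal_integral_eq_lintegral_ofReal hexp (Eventually.of_forall fun z => by positivity),
    integral_const_mul]
  have hcomplex := integral_charFun_mul_exp_neg_mul_sq_norm (autocorrelation ν) hb
  simp_rw [charFun_autocorrelation, ← Complex.ofReal_mul, integral_complex_ofReal] at hcomplex
  rw [← Complex.ofReal_injective hcomplex,
    ofReal_integral_eq_lintegral_ofReal hgauss (Eventually.of_forall fun ξ => by positivity)]
  congr 1 with ξ
  rw [ENNReal.ofReal_mul (by positivity), ENNReal.ofReal_pow (norm_nonneg _), ofReal_norm]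

/-- The Riesz energy of `ν` on the Fourier side, `∫ |ν̂(ξ)|² |ξ|^(-a) dξ`. -/
noncomputable def rieszEnergy (a : ℝ) (ν : Measure V) : ℝ≥0∞ :=
  ∫⁻ ξ, ‖charFun ν ξ‖ₑ ^ 2 * ENNReal.ofReal (‖ξ‖ ^ (-a))

theorem rieszEnergy_eq_lintegral_autocorrelation [Nontrivial V] (ha : 0 < a) (ν : Measure V)
    [IsFiniteMeasure ν] : rieszEnergy a ν = ∫⁻ z, rieszKernel a z ∂autocorrelation ν := by
  calc rieszEnergy a ν
      = ∫⁻ ξ, ∫⁻ b in Set.Ioi (0 : ℝ),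
          ENNReal.ofReal ((Real.Gamma (a / 2))⁻¹ * b ^ (a / 2 - 1)) *
            (‖charFun ν ξ‖ₑ ^ 2 * ENNReal.ofReal (Real.exp (-b * ‖ξ‖ ^ 2))) := by
        refine lintegral_congr_ae ((Measure.ae_ne volume (0 : V)).mono fun ξ hξ => ?_)
        dsimp only
        rw [ofReal_rpow_neg_eq_lintegral_gaussian ha (norm_pos_iff.2 hξ),
          ← lintegral_const_mul _ (by fun_prop)]
        simp only [mul_left_comm]
    _ = ∫⁻ b in Set.Ioi (0 : ℝ), ENNReal.ofReal ((Real.Gamma (a / 2))⁻¹ * b ^ (a / 2 - 1)) *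
          ∫⁻ ξ, ‖charFun ν ξ‖ₑ ^ 2 * ENNReal.ofReal (Real.exp (-b * ‖ξ‖ ^ 2)) := by
        rw [lintegral_lintegral_swap (Measurable.aemeasurable (by
          unfold Function.uncurry; fun_prop))]
        congr 1 with b
        exact lintegral_const_mul _ (by fun_prop)
    _ = ∫⁻ b in Set.Ioi (0 : ℝ), ∫⁻ z,
          ENNReal.ofReal ((Real.Gamma (a / 2))⁻¹ * b ^ (a / 2 - 1)) *
            ENNReal.ofReal ((Real.pi / b) ^ (Module.finrank ℝ V / 2 : ℝ) *
              Real.exp (-‖z‖ ^ 2 / (4 * b))) ∂autocorrelation ν := by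
        refine setLIntegral_congr_fun measurableSet_Ioi fun b (hb : 0 < b) => ?_
        rw [lintegral_enorm_charFun_sq_mul_gaussian ν hb, lintegral_const_mul _ (by fun_prop)]
    _ = ∫⁻ z, rieszKernel a z ∂autocorrelation ν :=
        lintegral_lintegral_swap (Measurable.aemeasurable (by
          unfold Function.uncurry; fun_prop))

theorem rieszEnergy_restrict [Nontrivial V] (ha : 0 < a) (μ : Measure V) [IsFiniteMeasure μ]
    (A : Set V) :
    rieszEnergy a (μ.restrict A) = ∫⁻ p in A ×ˢ A, rieszKernel a (p.1 - p.2) ∂μ.prod μ := by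
  rw [rieszEnergy_eq_lintegral_autocorrelation ha, autocorrelation,
    lintegral_map measurable_rieszKernel (by fun_prop), Measure.prod_restrict]

theorem rieszEnergy_restrict_le [Nontrivial V] (ha : 0 < a) (μ : Measure V) [IsFiniteMeasure μ]
    (A : Set V) : rieszEnergy a (μ.restrict A) ≤ rieszEnergy a μ := by
  conv_rhs => rw [← Measure.restrict_univ (μ := μ)]
  rw [rieszEnergy_restrict ha, rieszEnergy_restrict ha]
  exact lintegral_mono_set (Set.prod_mono (Set.subset_univ A) (Set.subset_univ A))

theorem tendsto_rieszEnergy_restrict [Nontrivial V] (ha : 0 < a) {μ : Measure V}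
    [IsFiniteMeasure μ] (hμ : rieszEnergy a μ ≠ ∞) {ι : Type*} {l : Filter ι} {A : ι → Set V}
    (hA : Tendsto (fun i => μ (A i)) l (𝓝 0)) :
    Tendsto (fun i => rieszEnergy a (μ.restrict (A i))) l (𝓝 0) := by
  rw [← Measure.restrict_univ (μ := μ), rieszEnergy_restrict ha, Set.univ_prod_univ,
    Measure.restrict_univ] at hμ
  simp_rw [rieszEnergy_restrict ha]
  refine tendsto_setLIntegral_zero hμ ?_
  simp only [Function.comp_def, Measure.prod_prod]
  simpa using ENNReal.Tendsto.mul hA (by simp) hA (by simp)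

theorem lintegral_enorm_charFun_mul_enorm_charFun_le (α β : Measure V) [IsFiniteMeasure α]
    [IsFiniteMeasure β] :
    ∫⁻ ξ, ‖charFun α ξ‖ₑ * ‖charFun β ξ‖ₑ * ENNReal.ofReal (‖ξ‖ ^ (-a)) ≤
      rieszEnergy a α ^ (1 / 2 : ℝ) * rieszEnergy a β ^ (1 / 2 : ℝ) := by
  refine le_of_eq_of_le (lintegral_congr fun ξ => ?_) (ENNReal.lintegral_mul_norm_pow_le
    (f := fun ξ => ‖charFun α ξ‖ₑ ^ 2 * ENNReal.ofReal (‖ξ‖ ^ (-a)))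
    (g := fun ξ => ‖charFun β ξ‖ₑ ^ 2 * ENNReal.ofReal (‖ξ‖ ^ (-a)))
    (by fun_prop) (by fun_prop) (by norm_num) (by norm_num) (by norm_num))
  rw [← ENNReal.mul_rpow_of_nonneg _ _ (by norm_num), ← ENNReal.rpow_two, ← ENNReal.rpow_two,
    mul_mul_mul_comm, ← ENNReal.mul_rpow_of_nonneg _ _ (by norm_num), ← sq, ← ENNReal.rpow_two,
    ← ENNReal.mul_rpow_of_nonneg _ _ (by norm_num), ← ENNReal.rpow_mul]
  norm_num

end RieszEnergy

/-! ### Vanishing for missing distances -/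

theorem exists_isCompact_seq_tendsto_measure_compl {X : Type*} [TopologicalSpace X]
    [T2Space X] [MeasurableSpace X] [OpensMeasurableSpace X] {μ : Measure X} [IsFiniteMeasure μ]
    [μ.InnerRegularCompactLTTop] {E : Set X} (hE : μ Eᶜ = 0) :
    ∃ K : ℕ → Set X, (∀ n, IsCompact (K n)) ∧ (∀ n, K n ⊆ E) ∧
      Tendsto (fun n => μ (K n)ᶜ) atTop (𝓝 0) := by
  let S := (toMeasurable μ Eᶜ)ᶜ
  have hSm : MeasurableSet S := (measurableSet_toMeasurable _ _).compl
  have hSE : S ⊆ E := Set.compl_subset_comm.1 (subset_toMeasurable _ _)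
  have hS : μ Sᶜ = 0 := by rw [compl_compl, measure_toMeasurable, hE]
  choose K hKS hK hKμ using fun n : ℕ => hSm.exists_isCompact_sdiff_lt (measure_ne_top μ S)
    (ENNReal.inv_ne_zero.2 (ENNReal.natCast_ne_top n))
  refine ⟨K, hK, fun n => (hKS n).trans hSE, tendsto_of_tendsto_of_tendsto_of_le_of_le
    tendsto_const_nhds ENNReal.tendsto_inv_nat_nhds_zero (fun _ => zero_le) fun n => ?_⟩
  calc μ (K n)ᶜ ≤ μ (S \ K n) + μ Sᶜ := by
        refine (measure_mono fun x hx => ?_).trans (measure_union_le _ _)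
        by_cases hxS : x ∈ S
        exacts [Or.inl ⟨hxS, hx⟩, Or.inr hxS]
    _ ≤ (n : ℝ≥0∞)⁻¹ := by rw [hS, add_zero]; exact (hKμ n).le

theorem exists_le_abs_norm_sub_sub {E : Type*} [SeminormedAddCommGroup E] {K : Set E}
    (hK : IsCompact K) {t : ℝ} (ht : ∀ x ∈ K, ∀ y ∈ K, ‖x - y‖ ≠ t) :
    ∃ r > 0, ∀ x ∈ K, ∀ y ∈ K, r ≤ |‖x - y‖ - t| := by
  obtain ⟨r, hr, hrK⟩ := (hK.prod hK).exists_forall_le'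
    (f := fun p : E × E => |‖p.1 - p.2‖ - t|) (Continuous.continuousOn (by fun_prop)) (a := 0)
    fun p hp => abs_pos.2 (sub_ne_zero.2 (ht _ hp.1 _ hp.2))
  exact ⟨r, hr, fun x hx y hy => hrK (x, y) ⟨hx, hy⟩⟩

theorem abs_sq_norm_add_sub_sq_norm_le {E : Type*} [SeminormedAddCommGroup E] (x y : E) :
    |‖x + y‖ ^ 2 - ‖x‖ ^ 2| ≤ ‖y‖ * ‖x + y‖ + ‖y‖ * ‖x‖ := by
  have h : |‖x + y‖ - ‖x‖| ≤ ‖y‖ := by simpa using abs_norm_sub_norm_le (x + y) x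
  rw [sq_sub_sq, abs_mul, abs_of_nonneg (by positivity), mul_comm, ← mul_add]
  gcongr

section Vanishing

variable {V : Type*} [NormedAddCommGroup V] [InnerProductSpace ℝ V] [MeasurableSpace V]
  [BorelSpace V]

theorem charFun_restrict_add_charFun_restrict_compl (μ : Measure V) [IsFiniteMeasure μ]
    {K : Set V} (hK : MeasurableSet K) (ξ : V) :
    charFun (μ.restrict K) ξ + charFun (μ.restrict Kᶜ) ξ = charFun μ ξ := by
  simp only [charFun_apply]
  exact integral_add_compl hK (Integrable.of_bound (Continuous.aestronglyMeasurable (by fun_prop))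
    1 (Eventually.of_forall fun x => (Complex.norm_exp_ofReal_mul_I _).le))

variable [FiniteDimensional ℝ V] {σ : Measure V}

theorem IsUniformSphereMeasure.integral_mul_cosTransform_eq_zero_of_isCompact
    (hσ : IsUniformSphereMeasure σ) {ν : Measure V} [IsFiniteMeasure ν] {K : Set V}
    (hK : IsCompact K) (hν : ∀ᵐ x ∂ν, x ∈ K) {t : ℝ} (ht : 0 ≤ t)
    (htK : ∀ x ∈ K, ∀ y ∈ K, ‖x - y‖ ≠ t)
    (hint : Integrable fun ξ => ‖charFun ν ξ‖ ^ 2 * cosTransform σ (t • ξ)) :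
    ∫ ξ, ‖charFun ν ξ‖ ^ 2 * cosTransform σ (t • ξ) = 0 := by
  have := hσ.isProbabilityMeasure
  obtain ⟨r, hr, hrK⟩ := exists_le_abs_norm_sub_sub hK htK
  let ρ : Measure V := autocorrelation ν ∗ σ.map (t • ·)
  have hcharFun : charFun ρ =
      fun ξ => ((‖charFun ν ξ‖ ^ 2 * cosTransform σ (t • ξ) : ℝ) : ℂ) := by
    ext ξ
    rw [charFun_conv, charFun_autocorrelation, charFun_map_smul, hσ.charFun_eq_cosTransform,
      Complex.ofReal_mul]
  have hdist : ∀ᵐ z ∂autocorrelation ν, r ≤ |‖z‖ - t| := by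
    rw [autocorrelation, ae_map_iff (by fun_prop) (measurableSet_le (by fun_prop) (by fun_prop))]
    filter_upwards [Measure.quasiMeasurePreserving_fst.ae hν,
      Measure.quasiMeasurePreserving_snd.ae hν] with p h₁ h₂ using hrK _ h₁ _ h₂
  have hsphere : ∀ᵐ z ∂σ.map (t • ·), ‖z‖ = t := by
    rw [ae_map_iff (by fun_prop) (measurableSet_eq_fun (by fun_prop) (by fun_prop))]
    filter_upwards [hσ.norm_eq_one] with θ hθ
    rw [norm_smul, hθ, mul_one, Real.norm_of_nonneg ht]
  have hρ : ∀ᵐ z ∂ρ, r ≤ ‖z‖ := by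
    refine ae_conv (measurableSet_le (by fun_prop) (by fun_prop)) hdist hsphere
      fun x y hx hy => hx.trans ?_
    simpa [hy] using abs_norm_sub_norm_le x (-y)
  have hzero := integral_charFun_eq_zero hr hρ (hcharFun ▸ hint.ofReal)
  simp_rw [hcharFun, integral_complex_ofReal] at hzero
  exact_mod_cast hzero

variable {a : ℝ} {D : ℝ≥0∞} {m : V → ℝ}

theorem integrable_sq_norm_charFun_mul {ν : Measure V} [IsFiniteMeasure ν]
    (hm : AEStronglyMeasurable m) (hD : D ≠ ∞)
    (hmD : ∀ᵐ ξ, ‖m ξ‖ₑ ≤ D * ENNReal.ofReal (‖ξ‖ ^ (-a))) (hν : rieszEnergy a ν ≠ ∞) :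
    Integrable fun ξ => ‖charFun ν ξ‖ ^ 2 * m ξ := by
  refine ⟨(Measurable.aestronglyMeasurable (by fun_prop)).mul hm, ?_⟩
  calc ∫⁻ ξ, ‖‖charFun ν ξ‖ ^ 2 * m ξ‖ₑ
      ≤ ∫⁻ ξ, D * (‖charFun ν ξ‖ₑ ^ 2 * ENNReal.ofReal (‖ξ‖ ^ (-a))) := by
        refine lintegral_mono_ae (hmD.mono fun ξ hξ => ?_)
        rw [enorm_mul, enorm_pow, enorm_norm, mul_left_comm]
        gcongr
    _ = D * rieszEnergy a ν := lintegral_const_mul' _ _ hD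
    _ < ∞ := ENNReal.mul_lt_top hD.lt_top hν.lt_top

theorem enorm_integral_sub_integral_restrict_le [Nontrivial V] (ha : 0 < a) {μ : Measure V}
    [IsFiniteMeasure μ] {K : Set V} (hK : MeasurableSet K) (hm : AEStronglyMeasurable m)
    (hD : D ≠ ∞) (hmD : ∀ᵐ ξ, ‖m ξ‖ₑ ≤ D * ENNReal.ofReal (‖ξ‖ ^ (-a)))
    (hμ : rieszEnergy a μ ≠ ∞) :
    ‖(∫ ξ, ‖charFun μ ξ‖ ^ 2 * m ξ) - ∫ ξ, ‖charFun (μ.restrict K) ξ‖ ^ 2 * m ξ‖ₑ ≤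
      D * (2 * (rieszEnergy a (μ.restrict Kᶜ) ^ (1 / 2 : ℝ) *
        rieszEnergy a μ ^ (1 / 2 : ℝ))) := by
  set ν := μ.restrict K
  set α := μ.restrict Kᶜ
  have hνμ : rieszEnergy a ν ≤ rieszEnergy a μ := rieszEnergy_restrict_le ha μ K
  have hν : rieszEnergy a ν ≠ ∞ := (hνμ.trans_lt hμ.lt_top).ne
  rw [← integral_sub (integrable_sq_norm_charFun_mul hm hD hmD hμ)
    (integrable_sq_norm_charFun_mul hm hD hmD hν)]
  refine (enorm_integral_le_lintegral_enorm _).trans ?_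
  let w : V → ℝ≥0∞ := fun ξ => ENNReal.ofReal (‖ξ‖ ^ (-a))
  calc ∫⁻ ξ, ‖‖charFun μ ξ‖ ^ 2 * m ξ - ‖charFun ν ξ‖ ^ 2 * m ξ‖ₑ
      ≤ ∫⁻ ξ, D * (‖charFun α ξ‖ₑ * ‖charFun μ ξ‖ₑ * w ξ +
          ‖charFun α ξ‖ₑ * ‖charFun ν ξ‖ₑ * w ξ) := by
        refine lintegral_mono_ae (hmD.mono fun ξ hξ => ?_)
        have hsq : ‖‖charFun μ ξ‖ ^ 2 - ‖charFun ν ξ‖ ^ 2‖ₑ ≤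
            ‖charFun α ξ‖ₑ * ‖charFun μ ξ‖ₑ + ‖charFun α ξ‖ₑ * ‖charFun ν ξ‖ₑ := by
          simp only [← ofReal_norm, ← ENNReal.ofReal_mul (norm_nonneg _)]
          rw [← ENNReal.ofReal_add (by positivity) (by positivity),
            ← charFun_restrict_add_charFun_restrict_compl μ hK ξ]
          exact ENNReal.ofReal_le_ofReal (abs_sq_norm_add_sub_sq_norm_le _ _)
        rw [← sub_mul, enorm_mul, ← add_mul, mul_left_comm]
        exact mul_le_mul' hsq hξ
    _ = D * ((∫⁻ ξ, ‖charFun α ξ‖ₑ * ‖charFun μ ξ‖ₑ * w ξ) +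
          ∫⁻ ξ, ‖charFun α ξ‖ₑ * ‖charFun ν ξ‖ₑ * w ξ) := by
        rw [lintegral_const_mul' _ _ hD, lintegral_add_left (by fun_prop)]
    _ ≤ D * (rieszEnergy a α ^ (1 / 2 : ℝ) * rieszEnergy a μ ^ (1 / 2 : ℝ) +
          rieszEnergy a α ^ (1 / 2 : ℝ) * rieszEnergy a μ ^ (1 / 2 : ℝ)) := by
        gcongr
        · exact lintegral_enorm_charFun_mul_enorm_charFun_le α μ
        · refine (lintegral_enorm_charFun_mul_enorm_charFun_le α ν).trans ?_
          gcongr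
    _ = _ := by rw [two_mul]

theorem IsUniformSphereMeasure.integral_mul_cosTransform_eq_zero [Nontrivial V]
    (hσ : IsUniformSphereMeasure σ) {μ : Measure V} [IsFiniteMeasure μ] {E : Set V}
    (hμE : μ Eᶜ = 0) {t : ℝ} (ht : 0 ≤ t) (htE : ∀ x ∈ E, ∀ y ∈ E, ‖x - y‖ ≠ t) (ha : 0 < a)
    (hD : D ≠ ∞) (hσD : ∀ᵐ ξ, ‖cosTransform σ (t • ξ)‖ₑ ≤ D * ENNReal.ofReal (‖ξ‖ ^ (-a)))
    (hμ : rieszEnergy a μ ≠ ∞) : ∫ ξ, ‖charFun μ ξ‖ ^ 2 * cosTransform σ (t • ξ) = 0 := by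
  have := hσ.isProbabilityMeasure
  have hm : AEStronglyMeasurable fun ξ => cosTransform σ (t • ξ) :=
    (continuous_cosTransform.comp (continuous_const_smul t)).aestronglyMeasurable
  obtain ⟨K, hK, hKE, hKlim⟩ := exists_isCompact_seq_tendsto_measure_compl hμE
  have hrestrict (n : ℕ) :
      ∫ ξ, ‖charFun (μ.restrict (K n)) ξ‖ ^ 2 * cosTransform σ (t • ξ) = 0 :=
    hσ.integral_mul_cosTransform_eq_zero_of_isCompact (hK n)
      (ae_restrict_mem (hK n).measurableSet) ht
      (fun x hx y hy => htE x (hKE n hx) y (hKE n hy))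
      (integrable_sq_norm_charFun_mul hm hD hσD
        ((rieszEnergy_restrict_le ha μ (K n)).trans_lt hμ.lt_top).ne)
  have hbound (n : ℕ) := enorm_integral_sub_integral_restrict_le ha (hK n).measurableSet hm hD
    hσD hμ
  simp only [hrestrict, sub_zero] at hbound
  have hlim : Tendsto (fun n => D * (2 * (rieszEnergy a (μ.restrict (K n)ᶜ) ^ (1 / 2 : ℝ) *
      rieszEnergy a μ ^ (1 / 2 : ℝ)))) atTop (𝓝 0) := by
    have henergy := (ENNReal.continuous_rpow_const (y := 1 / 2)).tendsto' 0 0 (by simp) |>.comp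
      (tendsto_rieszEnergy_restrict ha hμ hKlim)
    simpa using ENNReal.Tendsto.const_mul (ENNReal.Tendsto.const_mul
      (ENNReal.Tendsto.mul_const henergy (Or.inr (ENNReal.rpow_ne_top_of_nonneg (by norm_num) hμ)))
      (Or.inr ENNReal.ofNat_ne_top)) (Or.inr hD)
  exact enorm_eq_zero.1 (le_antisymm (ge_of_tendsto' hlim hbound) zero_le)

end Vanishing

/-! ### Fourier mass and the growth condition -/

theorem compl_ball_subset_iUnion_shell {E : Type*} [SeminormedAddCommGroup E] {X : ℝ}
    (hX : 0 < X) : (Metric.ball (0 : E) X)ᶜ ⊆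
      ⋃ k : ℕ, Metric.closedBall 0 (2 ^ (k + 1) * X) \ Metric.ball 0 (2 ^ k * X) := by
  intro ξ hξ
  have hXξ : X ≤ ‖ξ‖ := by simpa using hξ
  obtain ⟨k, hle, hlt⟩ := exists_nat_pow_near ((one_le_div hX).2 hXξ) one_lt_two
  exact Set.mem_iUnion.2 ⟨k, by simpa using ((div_lt_iff₀ hX).1 hlt).le,
    by simpa using (le_div_iff₀ hX).1 hle⟩

section FourierMass

variable {V : Type*} [NormedAddCommGroup V] [InnerProductSpace ℝ V] [MeasurableSpace V]
  [BorelSpace V] [FiniteDimensional ℝ V]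

/-- The function `𝔽_μ(T) = ∫_{|ξ| ≤ T} |μ̂(ξ)|² dξ`; the sign convention in `charFun` does not
affect the modulus. -/
noncomputable def fourierMass (μ : Measure V) (T : ℝ) : ℝ :=
  ∫ ξ in Metric.closedBall 0 T, ‖charFun μ ξ‖ ^ 2

/-- The growth hypothesis `𝔽_μ(T₁ T₂) ≤ T₁ ^ c 𝔽_μ(T₂)` for all `T₁, T₂ ≥ T₀`. -/
def HasFourierGrowth (μ : Measure V) (c T₀ : ℝ) : Prop :=
  ∀ T₁ T₂ : ℝ, T₀ ≤ T₁ → T₀ ≤ T₂ → fourierMass μ (T₁ * T₂) ≤ T₁ ^ c * fourierMass μ T₂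

theorem fourierMass_nonneg (μ : Measure V) (T : ℝ) : 0 ≤ fourierMass μ T :=
  integral_nonneg fun _ => by positivity

variable (μ : Measure V) [IsFiniteMeasure μ]

theorem integrableOn_sq_norm_charFun (T : ℝ) :
    IntegrableOn (fun ξ => ‖charFun μ ξ‖ ^ 2) (Metric.closedBall 0 T) := by
  refine IntegrableOn.of_bound measure_closedBall_lt_top
    (Measurable.aestronglyMeasurable (by fun_prop)) (μ.real Set.univ ^ 2)
    (Eventually.of_forall fun ξ => ?_)
  rw [norm_pow, norm_norm]
  gcongr
  exact norm_charFun_le ξ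

theorem fourierMass_mono : Monotone (fourierMass μ) := fun _ T h =>
  setIntegral_mono_set (integrableOn_sq_norm_charFun μ T)
    (Eventually.of_forall fun _ => by positivity)
    (Metric.closedBall_subset_closedBall h).eventuallyLE

theorem setLIntegral_enorm_charFun_sq (T : ℝ) :
    ∫⁻ ξ in Metric.closedBall 0 T, ‖charFun μ ξ‖ₑ ^ 2 = ENNReal.ofReal (fourierMass μ T) := by
  rw [fourierMass, ofReal_integral_eq_lintegral_ofReal (integrableOn_sq_norm_charFun μ T)
    (Eventually.of_forall fun _ => by positivity)]
  simp only [ENNReal.ofReal_pow (norm_nonneg _), ofReal_norm]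

variable {μ} {a c T₀ Q R : ℝ}

theorem lintegral_shell_le (μ : Measure V) [IsFiniteMeasure μ] (ha : 0 ≤ a) {X : ℝ} (hX : 0 < X)
    (Y : ℝ) :
    ∫⁻ ξ in Metric.closedBall 0 Y \ Metric.ball 0 X,
        ‖charFun μ ξ‖ₑ ^ 2 * ENNReal.ofReal (‖ξ‖ ^ (-a)) ≤
      ENNReal.ofReal (X ^ (-a) * fourierMass μ Y) := by
  calc ∫⁻ ξ in Metric.closedBall 0 Y \ Metric.ball 0 X,
        ‖charFun μ ξ‖ₑ ^ 2 * ENNReal.ofReal (‖ξ‖ ^ (-a))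
      ≤ ∫⁻ ξ in Metric.closedBall 0 Y \ Metric.ball 0 X,
          ‖charFun μ ξ‖ₑ ^ 2 * ENNReal.ofReal (X ^ (-a)) := by
        refine setLIntegral_mono' (measurableSet_closedBall.diff measurableSet_ball)
          fun ξ hξ => ?_
        have hXξ : X ≤ ‖ξ‖ := by simpa using hξ.2
        exact mul_right_mono (ENNReal.ofReal_le_ofReal
          (Real.rpow_le_rpow_of_nonpos hX hXξ (neg_nonpos.2 ha)))
    _ ≤ ∫⁻ ξ in Metric.closedBall 0 Y, ‖charFun μ ξ‖ₑ ^ 2 * ENNReal.ofReal (X ^ (-a)) :=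
        lintegral_mono_set Set.sdiff_subset
    _ = ENNReal.ofReal (X ^ (-a) * fourierMass μ Y) := by
        rw [lintegral_mul_const' _ _ ENNReal.ofReal_ne_top, setLIntegral_enorm_charFun_sq,
          ← ENNReal.ofReal_mul (fourierMass_nonneg μ Y), mul_comm]

theorem HasFourierGrowth.lintegral_dyadic_shell_le (h : HasFourierGrowth μ c T₀) (hT₀ : 0 < T₀)
    (ha : 0 ≤ a) (hQ : T₀ ≤ Q) (hR : T₀ ≤ R) (k : ℕ) :
    ∫⁻ ξ in Metric.closedBall 0 (2 ^ (k + 1) * (Q * R)) \ Metric.ball 0 (2 ^ k * (Q * R)),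
        ‖charFun μ ξ‖ₑ ^ 2 * ENNReal.ofReal (‖ξ‖ ^ (-a)) ≤
      ENNReal.ofReal ((Q * R) ^ (-a) * (2 * Q) ^ c * fourierMass μ R * (2 ^ (c - a)) ^ k) := by
  have hQ₀ : 0 < Q := hT₀.trans_le hQ
  have hR₀ : 0 < R := hT₀.trans_le hR
  refine (lintegral_shell_le μ ha (by positivity) _).trans (ENNReal.ofReal_le_ofReal ?_)
  have hgrowth : fourierMass μ (2 ^ (k + 1) * (Q * R)) ≤
      (2 ^ k * (2 * Q)) ^ c * fourierMass μ R := by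
    convert h (2 ^ k * (2 * Q)) R ?_ hR using 2
    · ring
    · nlinarith [one_le_pow₀ (one_le_two (α := ℝ)) (n := k)]
  calc (2 ^ k * (Q * R)) ^ (-a) * fourierMass μ (2 ^ (k + 1) * (Q * R))
      ≤ (2 ^ k * (Q * R)) ^ (-a) * ((2 ^ k * (2 * Q)) ^ c * fourierMass μ R) := by gcongr
    _ = (Q * R) ^ (-a) * (2 * Q) ^ c * fourierMass μ R * (2 ^ (c - a)) ^ k := by
        rw [Real.mul_rpow (x := 2 ^ k) (y := Q * R) (by positivity) (by positivity),
          Real.mul_rpow (x := 2 ^ k) (y := 2 * Q) (by positivity) (by positivity),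
          ← Real.rpow_pow_comm zero_le_two, ← Real.rpow_pow_comm zero_le_two,
          sub_eq_neg_add, Real.rpow_add two_pos, mul_pow]
        ring

theorem HasFourierGrowth.lintegral_compl_ball_le (h : HasFourierGrowth μ c T₀) (hT₀ : 0 < T₀)
    (ha : 0 ≤ a) (hca : c < a) (hQ : T₀ ≤ Q) (hR : T₀ ≤ R) :
    ∫⁻ ξ in (Metric.ball 0 (Q * R))ᶜ, ‖charFun μ ξ‖ₑ ^ 2 * ENNReal.ofReal (‖ξ‖ ^ (-a)) ≤
      ENNReal.ofReal ((Q * R) ^ (-a) * (2 * Q) ^ c * fourierMass μ R *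
        (1 - 2 ^ (c - a))⁻¹) := by
  have hQ₀ : 0 < Q := hT₀.trans_le hQ
  have hR₀ : 0 < R := hT₀.trans_le hR
  have hF := fourierMass_nonneg μ R
  have hr : (2 : ℝ) ^ (c - a) < 1 := Real.rpow_lt_one_of_one_lt_of_neg one_lt_two (by linarith)
  refine (lintegral_mono_set (compl_ball_subset_iUnion_shell (by positivity))).trans ?_
  refine (lintegral_iUnion_le _ _).trans ?_
  refine (ENNReal.tsum_le_tsum fun k => h.lintegral_dyadic_shell_le hT₀ ha hQ hR k).trans_eq ?_
  rw [← ENNReal.ofReal_tsum_of_nonneg (fun k => by positivity)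
    ((summable_geometric_of_lt_one (by positivity) hr).mul_left _), tsum_mul_left,
    tsum_geometric_of_lt_one (by positivity) hr]

theorem HasFourierGrowth.rieszEnergy_ne_top [Nontrivial V] (h : HasFourierGrowth μ c T₀)
    (hT₀ : 0 < T₀) (ha : 0 ≤ a) (hca : c < a) (han : a < Module.finrank ℝ V) :
    rieszEnergy a μ ≠ ∞ := by
  rw [rieszEnergy, ← lintegral_add_compl _ (measurableSet_ball (x := (0 : V)) (ε := T₀ * T₀))]
  refine ENNReal.add_ne_top.2 ⟨ne_of_lt ?_, ((h.lintegral_compl_ball_le hT₀ ha hca le_rfl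
    le_rfl).trans_lt ENNReal.ofReal_lt_top).ne⟩
  have hlocal : IntegrableOn (fun ξ : V => ‖charFun μ ξ‖ ^ 2 * ‖ξ‖ ^ (-a))
      (Metric.ball 0 (T₀ * T₀)) := by
    refine integrableOn_ball_of_norm_le_rpow (C := μ.real Set.univ ^ 2) Module.finrank_pos han
      (Eventually.of_forall fun ξ => ?_) (Measurable.aestronglyMeasurable (by fun_prop))
    rw [norm_mul, norm_pow, norm_norm, Real.norm_of_nonneg (by positivity)]
    gcongr
    exact norm_charFun_le ξ
  refine lt_of_eq_of_lt (lintegral_congr fun ξ => ?_) hlocal.2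
  rw [enorm_mul, enorm_pow, enorm_norm, Real.enorm_of_nonneg (by positivity)]

end FourierMass

/-! ### The annulus estimate -/

theorem sum_annuli_le {F : ℝ → ℝ} (hmono : Monotone F) (hF : ∀ T, 0 ≤ F T) {q : ℝ} {R : ℕ → ℝ}
    {J : ℕ} (hJ : 1 ≤ J) (hR : ∀ j, 1 ≤ j → j < J → q * R j ≤ R (j + 1)) :
    ∑ j ∈ Finset.Icc 1 J, (F (q * R j) - F (R j)) ≤ F (q * R J) := by
  induction J, hJ using Nat.le_induction with
  | base => simpa using hF (R 1)
  | succ n hn ih =>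
    rw [Finset.sum_Icc_succ_top (by lia)]
    have hsum := ih fun j h₁ h₂ => hR j h₁ (by lia)
    have hstep := hmono (hR n hn (by lia))
    linarith

theorem eventually_sq_div_two_add_mul_rpow_lt (D : ℝ) {ε η : ℝ} (hε : 0 < ε) (hη : 0 < η) :
    ∀ᶠ δ in 𝓝[>] (0 : ℝ), δ ^ 2 / 2 + D * δ ^ ε < η := by
  have hcont : ContinuousAt (fun δ : ℝ => δ ^ 2 / 2 + D * δ ^ ε) 0 :=
    ContinuousAt.add (by fun_prop) ((Real.continuousAt_rpow_const 0 ε (Or.inr hε.le)).const_mul D)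
  refine (hcont.eventually_lt_const ?_).filter_mono nhdsWithin_le_nhds
  simpa [Real.zero_rpow hε.ne'] using hη

theorem tendsto_inv_sq_nhdsGT_zero : Tendsto (fun δ : ℝ => (δ ^ 2)⁻¹) (𝓝[>] 0) atTop := by
  simpa only [inv_pow, Function.comp_def] using
    (tendsto_pow_atTop two_ne_zero).comp (tendsto_inv_nhdsGT_zero (𝕜 := ℝ))

section SphericalMean

variable {V : Type*} [NormedAddCommGroup V] [InnerProductSpace ℝ V] [MeasurableSpace V]
  {σ μ : Measure V} {a c C T₀ δ κ R : ℝ}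

theorem enorm_cosTransform_smul_le (hC : ∀ ξ, ξ ≠ 0 → |cosTransform σ ξ| ≤ C * ‖ξ‖ ^ (-a))
    {t : ℝ} (ht : 0 < t) {ξ : V} (hξ : ξ ≠ 0) :
    ‖cosTransform σ (t • ξ)‖ₑ ≤ ENNReal.ofReal (C * t ^ (-a)) * ENNReal.ofReal (‖ξ‖ ^ (-a)) := by
  have hdecay := hC _ (smul_ne_zero ht.ne' hξ)
  rw [norm_smul, Real.norm_of_nonneg ht.le, Real.mul_rpow ht.le (norm_nonneg ξ),
    ← mul_assoc] at hdecay
  rw [← ofReal_norm, Real.norm_eq_abs, ← ENNReal.ofReal_mul' (by positivity)]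
  exact ENNReal.ofReal_le_ofReal hdecay

theorem tail_constant_eq (hδ : 0 < δ) (hR : 0 < R) (F B : ℝ) :
    C * (δ / R) ^ (-a) * (((δ ^ 2)⁻¹ * R) ^ (-a) * (2 * (δ ^ 2)⁻¹) ^ c * F * B) =
      C * 2 ^ c * B * δ ^ (a - 2 * c) * F := by
  have hdecay : (δ / R) ^ (-a) * ((δ ^ 2)⁻¹ * R) ^ (-a) = δ ^ a := by
    rw [← Real.mul_rpow (by positivity) (by positivity),
      show δ / R * ((δ ^ 2)⁻¹ * R) = δ⁻¹ by field_simp, Real.rpow_neg_eq_inv_rpow, inv_inv]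
  have hgrowth : (2 * (δ ^ 2)⁻¹) ^ c = 2 ^ c * δ ^ (-(2 * c)) := by
    rw [Real.mul_rpow two_pos.le (by positivity), Real.inv_rpow (by positivity),
      Real.rpow_neg hδ.le, Real.rpow_mul hδ.le, Real.rpow_two]
  rw [sub_eq_add_neg, Real.rpow_add hδ, hgrowth, ← hdecay]
  ring

variable [BorelSpace V] [FiniteDimensional ℝ V] [IsFiniteMeasure μ]

theorem IsUniformSphereMeasure.one_sub_mul_fourierMass_le (hσ : IsUniformSphereMeasure σ)
    (hδ : 0 ≤ δ) (hR : 0 < R)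
    (hint : Integrable fun ξ => ‖charFun μ ξ‖ ^ 2 * cosTransform σ ((δ / R) • ξ)) :
    (1 - δ ^ 2 / 2) * fourierMass μ R ≤
      ∫ ξ in Metric.closedBall 0 R, ‖charFun μ ξ‖ ^ 2 * cosTransform σ ((δ / R) • ξ) := by
  rw [mul_comm, fourierMass, ← integral_mul_const]
  refine setIntegral_mono_on ((integrableOn_sq_norm_charFun μ R).mul_const _) hint.integrableOn
    measurableSet_closedBall fun ξ hξ => ?_
  have hnorm : ‖(δ / R) • ξ‖ ≤ δ := by
    rw [norm_smul, Real.norm_of_nonneg (by positivity), div_mul_comm]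
    exact mul_le_of_le_one_left hδ ((div_le_one hR).2 (mem_closedBall_zero_iff.1 hξ))
  have hcos := hσ.one_sub_sq_norm_div_two_le_cosTransform ((δ / R) • ξ)
  gcongr
  refine le_trans ?_ hcos
  gcongr

theorem neg_mul_fourierMass_sub_le (hκ : ∀ ξ, -κ ≤ cosTransform σ ξ) {S : ℝ} (hRS : R ≤ S)
    {t : ℝ} (hint : Integrable fun ξ => ‖charFun μ ξ‖ ^ 2 * cosTransform σ (t • ξ)) :
    -κ * (fourierMass μ S - fourierMass μ R) ≤
      ∫ ξ in Metric.closedBall 0 S \ Metric.closedBall 0 R,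
        ‖charFun μ ξ‖ ^ 2 * cosTransform σ (t • ξ) := by
  have hS := integrableOn_sq_norm_charFun μ S
  rw [fourierMass, fourierMass, ← setIntegral_sdiff measurableSet_closedBall hS
    (Metric.closedBall_subset_closedBall hRS), mul_comm, ← integral_mul_const]
  refine setIntegral_mono ((hS.mono_set Set.sdiff_subset).mul_const _) hint.integrableOn
    fun ξ => ?_
  exact mul_le_mul_of_nonneg_left (hκ _) (sq_nonneg _)

theorem HasFourierGrowth.neg_le_setIntegral_compl_closedBall (h : HasFourierGrowth μ c T₀)
    (hT₀ : 0 < T₀) (ha : 0 ≤ a) (hca : c < a) (hC₀ : 0 ≤ C)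
    (hC : ∀ ξ, ξ ≠ 0 → |cosTransform σ ξ| ≤ C * ‖ξ‖ ^ (-a))
    (hδ : 0 < δ) (hδT : T₀ ≤ (δ ^ 2)⁻¹) (hR : T₀ ≤ R) :
    -(C * 2 ^ c * (1 - 2 ^ (c - a))⁻¹ * δ ^ (a - 2 * c) * fourierMass μ R) ≤
      ∫ ξ in (Metric.closedBall 0 ((δ ^ 2)⁻¹ * R))ᶜ,
        ‖charFun μ ξ‖ ^ 2 * cosTransform σ ((δ / R) • ξ) := by
  have hR₀ : 0 < R := hT₀.trans_le hR
  have hF := fourierMass_nonneg μ R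
  have hB : 0 < (1 - (2 : ℝ) ^ (c - a))⁻¹ :=
    inv_pos.2 (sub_pos.2 (Real.rpow_lt_one_of_one_lt_of_neg one_lt_two (by linarith)))
  let B : Set V := Metric.ball 0 ((δ ^ 2)⁻¹ * R)
  refine neg_le_of_abs_le (ENNReal.ofReal_le_ofReal_iff (by positivity) |>.1 ?_)
  rw [← Real.norm_eq_abs, ofReal_norm]
  calc ‖∫ ξ in (Metric.closedBall 0 ((δ ^ 2)⁻¹ * R))ᶜ,
        ‖charFun μ ξ‖ ^ 2 * cosTransform σ ((δ / R) • ξ)‖ₑ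
      ≤ ∫⁻ ξ in Bᶜ, ‖‖charFun μ ξ‖ ^ 2 * cosTransform σ ((δ / R) • ξ)‖ₑ :=
        (enorm_integral_le_lintegral_enorm _).trans
          (lintegral_mono_set (Set.compl_subset_compl.2 Metric.ball_subset_closedBall))
    _ ≤ ∫⁻ ξ in Bᶜ, ENNReal.ofReal (C * (δ / R) ^ (-a)) *
          (‖charFun μ ξ‖ₑ ^ 2 * ENNReal.ofReal (‖ξ‖ ^ (-a))) := by
        refine setLIntegral_mono' measurableSet_ball.compl fun ξ hξ => ?_
        have hξ₀ : ξ ≠ 0 := by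
          rintro rfl
          exact hξ (Metric.mem_ball_self (by positivity))
        rw [enorm_mul, enorm_pow, enorm_norm, mul_left_comm]
        exact mul_right_mono (enorm_cosTransform_smul_le hC (by positivity) hξ₀)
    _ = ENNReal.ofReal (C * (δ / R) ^ (-a)) *
          ∫⁻ ξ in Bᶜ, ‖charFun μ ξ‖ₑ ^ 2 * ENNReal.ofReal (‖ξ‖ ^ (-a)) :=
        lintegral_const_mul' _ _ ENNReal.ofReal_ne_top
    _ ≤ ENNReal.ofReal (C * (δ / R) ^ (-a)) *
          ENNReal.ofReal (((δ ^ 2)⁻¹ * R) ^ (-a) * (2 * (δ ^ 2)⁻¹) ^ c * fourierMass μ R *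
            (1 - 2 ^ (c - a))⁻¹) :=
        mul_right_mono (h.lintegral_compl_ball_le hT₀ ha hca hδT hR)
    _ = _ := by
        rw [← ENNReal.ofReal_mul (by positivity), tail_constant_eq hδ hR₀]

theorem IsUniformSphereMeasure.fourierMass_le_mul_annulus [Nontrivial V]
    (hσ : IsUniformSphereMeasure σ) (hκ : ∀ ξ, -κ ≤ cosTransform σ ξ) (hC₀ : 0 ≤ C)
    (hC : ∀ ξ, ξ ≠ 0 → |cosTransform σ ξ| ≤ C * ‖ξ‖ ^ (-a)) (ha : 0 < a) (hca : c < a)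
    (han : a < Module.finrank ℝ V) (hgrowth : HasFourierGrowth μ c T₀) (hT₀ : 0 < T₀)
    (hδ : 0 < δ) (hδ₁ : δ ≤ 1) (hδT : T₀ ≤ (δ ^ 2)⁻¹) (hR : T₀ ≤ R)
    {E : Set V} (hμE : μ Eᶜ = 0) (hE : ∀ x ∈ E, ∀ y ∈ E, ‖x - y‖ ≠ δ / R) :
    (1 - (δ ^ 2 / 2 + C * 2 ^ c * (1 - 2 ^ (c - a))⁻¹ * δ ^ (a - 2 * c))) * fourierMass μ R ≤
      κ * (fourierMass μ ((δ ^ 2)⁻¹ * R) - fourierMass μ R) := by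
  have := hσ.isProbabilityMeasure
  have hR₀ : 0 < R := hT₀.trans_le hR
  have hRS : R ≤ (δ ^ 2)⁻¹ * R :=
    le_mul_of_one_le_left hR₀.le ((one_le_inv₀ (by positivity)).2 (pow_le_one₀ hδ.le hδ₁))
  have henergy := hgrowth.rieszEnergy_ne_top hT₀ ha.le hca han
  have hdecay : ∀ᵐ ξ : V, ‖cosTransform σ ((δ / R) • ξ)‖ₑ ≤
      ENNReal.ofReal (C * (δ / R) ^ (-a)) * ENNReal.ofReal (‖ξ‖ ^ (-a)) :=
    (Measure.ae_ne volume 0).mono fun ξ hξ => enorm_cosTransform_smul_le hC (by positivity) hξ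
  have hint : Integrable fun ξ => ‖charFun μ ξ‖ ^ 2 * cosTransform σ ((δ / R) • ξ) :=
    integrable_sq_norm_charFun_mul
      (continuous_cosTransform.comp (continuous_const_smul _)).aestronglyMeasurable
      ENNReal.ofReal_ne_top hdecay henergy
  have hzero := hσ.integral_mul_cosTransform_eq_zero hμE (by positivity) hE ha
    ENNReal.ofReal_ne_top hdecay henergy
  have hwhole := integral_add_compl
    (measurableSet_closedBall (x := (0 : V)) (ε := (δ ^ 2)⁻¹ * R)) hint
  have hsplit := setIntegral_sdiff measurableSet_closedBall hint.integrableOn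
    (Metric.closedBall_subset_closedBall (x := (0 : V)) hRS)
  have hball := hσ.one_sub_mul_fourierMass_le hδ.le hR₀ hint
  have hannulus := neg_mul_fourierMass_sub_le hκ hRS hint
  have htail := hgrowth.neg_le_setIntegral_compl_closedBall hT₀ ha.le hca hC₀ hC hδ hδT hR
  linarith

end SphericalMean

section Distances

variable {V : Type*} [NormedAddCommGroup V] [InnerProductSpace ℝ V] [MeasurableSpace V]
  [BorelSpace V] [FiniteDimensional ℝ V]

theorem exists_two_mul_fourierMass_le_annulus (hV : 2 ≤ Module.finrank ℝ V) {c : ℝ}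
    (hc : c < ((Module.finrank ℝ V : ℝ) - 1) / 4) {T₀ : ℝ} (hT₀ : 0 < T₀) :
    ∃ δ₀ > 0, ∀ (μ : Measure V) [IsFiniteMeasure μ], HasFourierGrowth μ c T₀ →
      ∀ δ, 0 < δ → δ < δ₀ → ∀ R, T₀ ≤ R → ∀ E : Set V, μ Eᶜ = 0 →
        (∀ x ∈ E, ∀ y ∈ E, ‖x - y‖ ≠ δ / R) →
          2 * fourierMass μ R ≤ fourierMass μ ((δ ^ 2)⁻¹ * R) - fourierMass μ R := by
  have : Nontrivial V := Module.nontrivial_of_finrank_pos (R := ℝ) (by lia)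
  have hV' : (2 : ℝ) ≤ Module.finrank ℝ V := by exact_mod_cast hV
  obtain ⟨σ, hσ⟩ := exists_isUniformSphereMeasure (V := V)
  obtain ⟨C, hC₀, hC⟩ := hσ.exists_abs_cosTransform_le
  obtain ⟨κ, hκ₀, hκ_lt, hκ⟩ := hσ.exists_neg_le_cosTransform (by lia)
  set a : ℝ := ((Module.finrank ℝ V : ℝ) - 1) / 2 with ha
  have hsmall := eventually_sq_div_two_add_mul_rpow_lt (C * 2 ^ c * (1 - 2 ^ (c - a))⁻¹)
    (show 0 < a - 2 * c by linarith) (show 0 < 1 - 2 * κ by linarith)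
  have hlarge := tendsto_inv_sq_nhdsGT_zero.eventually_ge_atTop T₀
  have hle_one : ∀ᶠ δ : ℝ in 𝓝[>] 0, δ ≤ 1 := eventually_nhdsWithin_of_eventually_nhds
    (eventually_le_nhds one_pos)
  obtain ⟨δ₀, hδ₀, hIoo⟩ := mem_nhdsGT_iff_exists_Ioo_subset.1 (hsmall.and (hlarge.and hle_one))
  refine ⟨δ₀, hδ₀, fun μ _ hgrowth δ hδ hδδ₀ R hR E hμE hE => ?_⟩
  obtain ⟨hδε, hδT, hδ₁⟩ := hIoo ⟨hδ, hδδ₀⟩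
  have hannulus := hσ.fourierMass_le_mul_annulus hκ hC₀.le hC (by linarith) (by linarith)
    (by linarith) hgrowth hT₀ hδ hδ₁ hδT hR hμE hE
  refine le_of_mul_le_mul_left (le_trans ?_ hannulus) hκ₀
  nlinarith [fourierMass_nonneg μ R]

theorem theorem1p5_general (hV : 2 ≤ Module.finrank ℝ V) {c : ℝ}
    (hc : c < ((Module.finrank ℝ V : ℝ) - 1) / 4) {T₀ : ℝ} (hT₀ : 0 < T₀) :
    ∃ δ₀ > 0, ∀ (E : Set V) (μ : Measure V) [IsFiniteMeasure μ], μ Eᶜ = 0 →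
      HasFourierGrowth μ c T₀ → ∀ δ, 0 < δ → δ < δ₀ → ∀ J, 1 ≤ J → ∀ R : ℕ → ℝ,
        (∀ j, 1 ≤ j → j ≤ J → T₀ ≤ R j) →
        (∀ j, 1 ≤ j → j < J → (δ ^ 2)⁻¹ * R j ≤ R (j + 1)) →
        1 / 2 * fourierMass μ ((δ ^ 2)⁻¹ * R J) < ∑ j ∈ Finset.Icc 1 J, fourierMass μ (R j) →
        ∃ j, 1 ≤ j ∧ j ≤ J ∧ ∃ x ∈ E, ∃ y ∈ E, ‖x - y‖ = δ / R j := by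
  obtain ⟨δ₀, hδ₀, h⟩ := exists_two_mul_fourierMass_le_annulus hV hc hT₀
  refine ⟨δ₀, hδ₀, fun E μ _ hμE hgrowth δ hδ hδδ₀ J hJ R hR hlac hsum => ?_⟩
  by_contra! hE
  have hannuli : ∑ j ∈ Finset.Icc 1 J, 2 * fourierMass μ (R j) ≤
      ∑ j ∈ Finset.Icc 1 J, (fourierMass μ ((δ ^ 2)⁻¹ * R j) - fourierMass μ (R j)) := by
    refine Finset.sum_le_sum fun j hj => ?_
    obtain ⟨h₁, h₂⟩ := Finset.mem_Icc.1 hj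
    exact h μ hgrowth δ hδ hδδ₀ _ (hR j h₁ h₂) E hμE (hE j h₁ h₂)
  rw [← Finset.mul_sum] at hannuli
  have hdisjoint := sum_annuli_le (fourierMass_mono μ) (fourierMass_nonneg μ) hJ hlac
  linarith

end Distances

section EuclideanSpace

variable {d : ℕ} (μ : Measure (EuclideanSpace ℝ (Fin d)))

theorem norm_measureFourier (ξ : EuclideanSpace ℝ (Fin d)) :
    ‖measureFourier μ ξ‖ = ‖charFun μ ξ‖ := by
  have h : measureFourier μ ξ = charFun μ (-ξ) := by
    simp only [measureFourier, charFun_apply, inner_neg_right, Complex.ofReal_neg, neg_mul,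
      mul_comm Complex.I]
  rw [h, charFun_neg, RCLike.norm_conj]

theorem partialFourierIntegral_eq_fourierMass : partialFourierIntegral μ = fourierMass μ := by
  ext T
  simp only [partialFourierIntegral, norm_measureFourier, fourierMass, Metric.closedBall,
    dist_zero_right]

end EuclideanSpace

theorem theorem1p5 (d : ℕ) (hd : 2 ≤ d) (c : ℝ) (hc₀ : 0 < c) (hc : c < ((d : ℝ) - 1) / 4)
    (T₀ : ℝ) (hT₀ : 1 ≤ T₀) (M : ℝ) (hM : 4 ≤ M) :
    ∃ δM : ℝ, 0 < δM ∧
      ∀ (E : Set (EuclideanSpace ℝ (Fin d))), E ⊆ unitCube d →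
      ∀ (μ : Measure (EuclideanSpace ℝ (Fin d))), IsProbabilityMeasure μ → μ Eᶜ = 0 →
        (∀ T₁ T₂ : ℝ, T₀ ≤ T₁ → T₀ ≤ T₂ →
          partialFourierIntegral μ (T₁ * T₂) ≤ T₁ ^ c * partialFourierIntegral μ T₂) →
      ∀ (δ : ℝ), 0 < δ → δ < δM →
      ∀ (J : ℕ), 1 ≤ J → ∀ (R : ℕ → ℝ),
        (∀ j : ℕ, 1 ≤ j → j ≤ J → T₀ < R j) →
        (∀ j : ℕ, 1 ≤ j → j < J → (δ ^ 2)⁻¹ * R j ≤ R (j + 1)) →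
        (1 - 2 / M) * partialFourierIntegral μ ((δ ^ 2)⁻¹ * R J)
          < ∑ j ∈ Finset.Icc 1 J, partialFourierIntegral μ (R j) →
        ∃ j : ℕ, 1 ≤ j ∧ j ≤ J ∧ δ / R j ∈ distanceSet E := by
  obtain ⟨δ₀, hδ₀, h⟩ := theorem1p5_general (V := EuclideanSpace ℝ (Fin d)) (c := c) (T₀ := T₀)
    (by simpa using hd) (by simpa using hc) (by linarith)
  refine ⟨δ₀, hδ₀, fun E _ μ _ hμE hgrowth δ hδ hδδ₀ J hJ R hR hlac hsum => ?_⟩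
  rw [partialFourierIntegral_eq_fourierMass] at hgrowth hsum
  refine h E μ hμE hgrowth δ hδ hδδ₀ J hJ R (fun j h₁ h₂ => (hR j h₁ h₂).le) hlac
    (hsum.trans_le' (mul_le_mul_of_nonneg_right ?_ (fourierMass_nonneg μ _)))
  have hM' : 2 / M ≤ 1 / 2 := by
    rw [div_le_div_iff₀] <;> linarith
  linarith
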